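/- **Proposition 3.1 (Clifford's inequality).** Let $k$ be an algebraically closed field and let $X=C_1\cup C_2$ be a binary curve of genus $g\geq 1$ over $k$, i.e. a reduced nodal curve with two irreducible components, both isomorphic to $\mathbb P^1$, which meet in $g+1$ nodes. Let $d$ be an integer with $0\leq d\leq 2g$. A multidegree $(d_1,d_2)$ with $d_1+d_2=d$ is called balanced on a binary curve of genus $g$ if $\frac{d-g-1}{2}\leq d_i\leq\frac{d+g+1}{2}$ for $i=1,2$, and strictly balanced if these inequalities are strict; a line bundle is called (strictly) balanced if its multidegree is. 1. Every balanced line bundle $L$ of degree $d$ on $X$ satisfies $h^0(X,L)\leq d/2+1$. If $d=0$ and $h^0(X,L)=1$, then $L\cong\mathcal O_X$. If $d=2g-2$ and $h^0(X,L)=g$, then $L\cong\omega_X$, the dualizing sheaf. 2. For every point $[\widehat L]$ of the degree-$d$ compactified Jacobian $\overline{P^d_X}$ we have $h^0(\widehat L)\leq d/2+1$. That is: let $S$ be any set of nodes of $X$, let $Y_S$ be the normalization of $X$ at $S$ (a binary curve of genus $g-\#S$), and let $\widehat X_S$ be the blow-up of $X$ at $S$, i.e. the union of $Y_S$ and of one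 copy $E_n\cong\mathbb P^1$ for each $n\in S$, where $E_n$ meets $Y_S$ in two nodes, at the two points over $n$. Then $h^0(\widehat X_S,\widehat L)\leq d/2+1$ for every balanced line bundle $\widehat L$ of total degree $d$ on $\widehat X_S$, i.e. every $\widehat L$ that has degree $1$ on every $E_n$ and whose restriction to $Y_S$ has balanced multidegree on $Y_S$. Here the points of $\overline{P^d_X}$ are the classes of such $\widehat L$, for all $S$, where two bundles on the same $\widehat X_S$ with isomorphic restrictions to $Y_S$ represent the same point, and where all those that are not strictly balanced on $Y_S$ represent one and the same point. -/

import Mathlib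

universe u

noncomputable section

open Polynomial

/-! ## The projective line over `k`, with coordinate `t = RatFunc.X`

Its closed points are the elements of `OnePoint k`, its function field is `RatFunc k`. -/

namespace P1

variable {k : Type u} [Field k]

/-- A local parameter at a point: `t - a` at `a`, and `1 / t` at infinity. -/
def param (p : OnePoint k) : RatFunc k :=
  p.elim (RatFunc.X)⁻¹ (fun a => RatFunc.X - RatFunc.C a)

/-- The differential of the local parameter is `dparam p * dt`. -/
def dparam (p : OnePoint k) : RatFunc k :=
  p.elim (-(RatFunc.X ^ 2)⁻¹) (fun _ => 1)

/-- The order of vanishing of a (nonzero) rational function at a point. -/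
def ord (p : OnePoint k) (f : RatFunc k) : ℤ :=
  p.elim (-f.intDegree)
    (fun a => (f.num.rootMultiplicity a : ℤ) - (f.denom.rootMultiplicity a : ℤ))

/-- The rational function `f` is regular at `p` and its value there is `c`: it is a quotient `P / Q`
of polynomials in the local parameter, with `Q` not vanishing at `p` and `P(p) = c Q(p)`. -/
def HasValue (p : OnePoint k) (f : RatFunc k) (c : k) : Prop :=
  ∃ P Q : k[X], Q.eval 0 ≠ 0 ∧ f * aeval (param p) Q = aeval (param p) P ∧
    P.eval 0 = c * Q.eval 0

/-- The rational differential `f dt` has at most a simple pole at `p`, with residue `c`: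
if `z` is the local parameter, then `f dt = (f / dparam) dz` and `z * (f / dparam)` is regular
with value `c`. -/
def HasResidue (p : OnePoint k) (f : RatFunc k) (c : k) : Prop :=
  HasValue p (param p * (f / dparam p)) c

theorem hasValue_const (p : OnePoint k) (c : k) : HasValue p (algebraMap k (RatFunc k) c) c :=
  ⟨C c, 1, by simp, by simp, by simp⟩

theorem HasValue.add {p : OnePoint k} {f g : RatFunc k} {a b : k}
    (hf : HasValue p f a) (hg : HasValue p g b) : HasValue p (f + g) (a + b) := by
  obtain ⟨P, Q, h1, h2, h3⟩ := hf
  obtain ⟨R, S, h4, h5, h6⟩ := hg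
  refine ⟨P * S + R * Q, Q * S, by simp [h1, h4], ?_, ?_⟩
  · simp only [map_add, map_mul, ← h2, ← h5]; ring
  · simp only [eval_add, eval_mul, h3, h6]; ring

theorem HasValue.mul {p : OnePoint k} {f g : RatFunc k} {a b : k}
    (hf : HasValue p f a) (hg : HasValue p g b) : HasValue p (f * g) (a * b) := by
  obtain ⟨P, Q, h1, h2, h3⟩ := hf
  obtain ⟨R, S, h4, h5, h6⟩ := hg
  refine ⟨P * R, Q * S, by simp [h1, h4], ?_, ?_⟩
  · simp only [map_mul, ← h2, ← h5]; ring
  · simp only [eval_mul, h3, h6]; ring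

theorem HasValue.neg {p : OnePoint k} {f : RatFunc k} {a : k}
    (hf : HasValue p f a) : HasValue p (-f) (-a) := by
  obtain ⟨P, Q, h1, h2, h3⟩ := hf
  exact ⟨-P, Q, h1, by simp [← h2], by simp [h3]⟩

theorem param_ne_zero (p : OnePoint k) : param p ≠ 0 := by
  induction p using OnePoint.rec with
  | infty => exact inv_ne_zero RatFunc.X_ne_zero
  | coe a =>
    change RatFunc.X - RatFunc.C a ≠ 0
    rw [← RatFunc.algebraMap_X, ← RatFunc.algebraMap_C, ← map_sub]
    exact (map_ne_zero_iff _ (RatFunc.algebraMap_injective k)).2 (X_sub_C_ne_zero a)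

theorem dparam_ne_zero (p : OnePoint k) : dparam p ≠ 0 := by
  induction p using OnePoint.rec with
  | infty => exact neg_ne_zero.2 (inv_ne_zero (pow_ne_zero _ RatFunc.X_ne_zero))
  | coe a => exact one_ne_zero

end P1

/-! ## Nodal curves with smooth rational components -/

/-- A reduced nodal curve over `k` all of whose irreducible components are isomorphic to `ℙ¹`.
Such a curve is the disjoint union of its components (indexed by `Comp`), with the two points
`branch n 0` and `branch n 1`, on two different components, glued to an ordinary double point, for
every node `n`. -/
structure NodalCurve (k : Type u) where
  Comp : Type
  Node : Type
  [finite_comp : Finite Comp]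
  [finite_node : Finite Node]
  branch : Node → Fin 2 → Comp × OnePoint k
  branch_injective : Function.Injective fun b : Node × Fin 2 => branch b.1 b.2
  comp_ne : ∀ n, (branch n 0).1 ≠ (branch n 1).1

attribute [instance] NodalCurve.finite_comp NodalCurve.finite_node

namespace NodalCurve

variable {k : Type u} (X : NodalCurve k)

/-- The closed points of `X`: the points of the components that are no branch of a node, and the
nodes. -/
inductive Point : Type u
  | smooth (b : X.Comp × OnePoint k) (hb : ∀ n j, X.branch n j ≠ b) : Point
  | node (n : X.Node) : Point

variable {X} in
/-- The points of the components (the normalization) that lie over a point of `X`. -/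
def Point.over : X.Point → Set (X.Comp × OnePoint k)
  | .smooth b _ => {b}
  | .node n => Set.range (X.branch n)

open Classical in
/-- The normalization map: the image in `X` of a point of a component. -/
def proj (b : X.Comp × OnePoint k) : X.Point :=
  if h : ∃ n j, X.branch n j = b then .node h.choose
  else .smooth b fun n j hnj => h ⟨n, j, hnj⟩

theorem mem_over_iff (x : X.Point) (b : X.Comp × OnePoint k) : b ∈ x.over ↔ X.proj b = x := by
  unfold proj
  cases x with
  | smooth c hc =>
    simp only [Point.over, Set.mem_singleton_iff]
    constructor
    · rintro rfl
      rw [dif_neg (by rintro ⟨n, j, h⟩; exact hc n j h)]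
    · split_ifs with h
      · simp
      · intro h'; simpa using h'
  | node n =>
    simp only [Point.over, Set.mem_range]
    constructor
    · rintro ⟨j, rfl⟩
      have h : ∃ m i, X.branch m i = X.branch n j := ⟨n, j, rfl⟩
      rw [dif_pos h]
      obtain ⟨i, hi⟩ := h.choose_spec
      have := X.branch_injective (a₁ := (h.choose, i)) (a₂ := (n, j)) hi
      exact congrArg Point.node (Prod.mk.inj this).1
    · split_ifs with h
      · intro h'
        rw [← Point.node.inj h']
        exact h.choose_spec
      · simp

variable [Field k]

/-- The ring of rational functions on `X`, the product of the function fields of the components. -/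
abbrev FunctionRing : Type u := X.Comp → RatFunc k

/-- The rational functions on `X` that are regular at `x`: on all the branches through `x` they are
regular, with the same value. -/
def localRing (x : X.Point) : Subalgebra k X.FunctionRing where
  carrier := {f | ∃ c, ∀ b ∈ x.over, P1.HasValue b.2 (f b.1) c}
  add_mem' := by
    rintro f g ⟨a, ha⟩ ⟨b, hb⟩
    exact ⟨a + b, fun y hy => (ha y hy).add (hb y hy)⟩
  mul_mem' := by
    rintro f g ⟨a, ha⟩ ⟨b, hb⟩
    exact ⟨a * b, fun y hy => (ha y hy).mul (hb y hy)⟩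
  algebraMap_mem' c := ⟨c, fun y _ => P1.hasValue_const y.2 c⟩

/-- A basis vector of a free module of rank one over the ring of rational functions. -/
def IsFrame {V : Type u} [AddCommGroup V] [Module X.FunctionRing V] (e : V) : Prop :=
  Function.Bijective fun f : X.FunctionRing => f • e

/-- `e` is a frame of the module `V` and generates the submodule `M` over the local ring at `x`. -/
def Generates {V : Type u} [AddCommGroup V] [Module X.FunctionRing V] {x : X.Point}
    (M : Submodule (X.localRing x) V) (e : V) : Prop :=
  X.IsFrame e ∧ ∀ v, v ∈ M ↔ ∃ f ∈ X.localRing x, v = f • e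

/-- A line bundle (invertible sheaf) `L` on `X`, given by its module `Rat` of rational sections,
which is free of rank one over the ring of rational functions, and, for every point `x`, the module
`germ x` of rational sections that are regular at `x`. It is locally free of rank one: every
`germ x` has a generator, and some rational section generates it for all but finitely many `x`.
(The sections of `L` over a dense open set `U` are the rational sections that are regular at all
points of `U`, and a generator at `x` is a generator on a neighbourhood of `x`.) -/
structure LineBundle where
  Rat : Type u
  [addCommGroup : AddCommGroup Rat]
  [moduleBase : Module k Rat]
  [module : Module X.FunctionRing Rat]
  [isScalarTower : IsScalarTower k X.FunctionRing Rat]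
  germ : ∀ x : X.Point, Submodule (X.localRing x) Rat
  exists_generator : ∀ x, ∃ e, X.Generates (germ x) e
  exists_section : ∃ s, X.IsFrame s ∧ {x | ¬ X.Generates (germ x) s}.Finite

end NodalCurve

namespace NodalCurve.LineBundle

variable {k : Type u} [Field k] {X : NodalCurve k} (L M : X.LineBundle)

attribute [instance] addCommGroup moduleBase module isScalarTower

/-- The space of global sections `H⁰(X, L)`. -/
def H0 : Submodule k L.Rat where
  carrier := {v | ∀ x, v ∈ L.germ x}
  add_mem' hv hw x := add_mem (hv x) (hw x)
  zero_mem' x := zero_mem _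
  smul_mem' c v hv x := by
    have h := (L.germ x).smul_mem (algebraMap k (X.localRing x) c) (hv x)
    have e : algebraMap k (X.localRing x) c • v = c • v := by
      change algebraMap k X.FunctionRing c • v = c • v
      exact algebraMap_smul _ _ _
    rwa [e] at h

/-- `h⁰(X, L)`, to be used together with the finite-dimensionality of `H⁰(X, L)`. -/
def h0 : ℕ := Module.finrank k L.H0

/-- A rational section of `L` that vanishes identically on no component. -/
def sec : L.Rat := L.exists_section.choose

/-- A generator of `L` at `x`. -/
def gen (x : X.Point) : L.Rat := (L.exists_generator x).choose

/-- The coordinate of `v` with respect to the generator of `L` at `x`. -/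
def coord (x : X.Point) (v : L.Rat) : X.FunctionRing :=
  (Equiv.ofBijective _ (L.exists_generator x).choose_spec.1).symm v

/-- The degree of the restriction of `L` to the component `i`: the number of zeros minus the number
of poles of a rational section on this component. -/
def degree (i : X.Comp) : ℤ :=
  ∑ᶠ p : OnePoint k, P1.ord p (L.coord (X.proj (i, p)) L.sec i)

/-- The total degree of `L`. -/
def totalDegree : ℤ := ∑ᶠ i, L.degree i

/-- Isomorphism of line bundles: an isomorphism between the modules of rational sections that
matches regular sections at every point. -/
def Iso : Prop :=
  ∃ φ : L.Rat ≃ₗ[X.FunctionRing] M.Rat, ∀ x v, v ∈ L.germ x ↔ φ v ∈ M.germ x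

open Classical in
/-- Isomorphism of the restrictions of two line bundles to the subcurve `Y` formed by the components
in `T`: multiplication by the indicator function of `T` restricts rational sections to `Y`, and a
rational section on `Y` is regular at a point of `Y` if it is the restriction to `Y` of a section
that is regular there. -/
def RestrictIso (T : Set X.Comp) : Prop :=
  ∃ φ : L.Rat ≃ₗ[X.FunctionRing] M.Rat, ∀ x : X.Point, (∃ b ∈ x.over, b.1 ∈ T) → ∀ v,
    (∃ w ∈ L.germ x, T.indicator (1 : X.FunctionRing) • w
      = T.indicator (1 : X.FunctionRing) • v) ↔
    (∃ w ∈ M.germ x, T.indicator (1 : X.FunctionRing) • w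
      = T.indicator (1 : X.FunctionRing) • φ v)

end NodalCurve.LineBundle

namespace NodalCurve

variable {k : Type u} [Field k] (X : NodalCurve k)

theorem isFrame_iff (e : X.FunctionRing) : X.IsFrame e ↔ ∀ i, e i ≠ 0 := by
  constructor
  · intro h i hi
    obtain ⟨f, hf⟩ := h.2 1
    have := congrFun hf i
    simp [hi] at this
  · intro h
    refine ⟨fun f g hfg => ?_, fun v => ⟨fun i => v i / e i, ?_⟩⟩
    · funext i
      exact mul_right_cancel₀ (h i) (congrFun hfg i)
    · funext i
      exact div_mul_cancel₀ _ (h i)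

/-- The structure sheaf of `X`. -/
def structureSheaf : X.LineBundle where
  Rat := X.FunctionRing
  germ x :=
    { carrier := {f | f ∈ X.localRing x}
      add_mem' := fun hf hg => (X.localRing x).add_mem hf hg
      zero_mem' := zero_mem (X.localRing x)
      smul_mem' := fun r _ hf => mul_mem r.2 hf }
  exists_generator x := ⟨1, (X.isFrame_iff 1).2 (by simp), fun v =>
    ⟨fun hv => ⟨v, hv, (mul_one v).symm⟩, by
      rintro ⟨f, hf, rfl⟩
      exact (X.localRing x).mul_mem hf (X.localRing x).one_mem⟩⟩
  exists_section := by
    refine ⟨1, (X.isFrame_iff 1).2 (by simp), Set.Finite.subset Set.finite_empty ?_⟩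
    intro x hx
    refine hx ⟨(X.isFrame_iff 1).2 (by simp), fun v =>
    ⟨fun hv => ⟨v, hv, (mul_one v).symm⟩, ?_⟩⟩
    rintro ⟨f, hf, rfl⟩
    exact (X.localRing x).mul_mem hf (X.localRing x).one_mem

/-- The condition for the rational differential `v i * dt` (on the components `i`) to be a section
of the dualizing sheaf at `x`: it is regular if `x` is a smooth point; if `x` is a node, it has at
most simple poles on the two branches, with opposite residues. -/
def IsDualizing (x : X.Point) (v : X.FunctionRing) : Prop :=
  match x with
  | .smooth b _ => ∃ c, P1.HasValue b.2 (v b.1 / P1.dparam b.2) c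
  | .node n => ∃ c, P1.HasResidue (X.branch n 0).2 (v (X.branch n 0).1) c ∧
      P1.HasResidue (X.branch n 1).2 (v (X.branch n 1).1) (-c)

open Classical in
/-- A local generator of the dualizing sheaf. -/
def dualGen (x : X.Point) : X.FunctionRing :=
  match x with
  | .smooth b _ => fun _ => P1.dparam b.2
  | .node n => fun i => if i = (X.branch n 0).1
      then P1.dparam (X.branch n 0).2 / P1.param (X.branch n 0).2
      else -(P1.dparam (X.branch n 1).2 / P1.param (X.branch n 1).2)

theorem dualGen_ne_zero (x : X.Point) (i : X.Comp) : X.dualGen x i ≠ 0 := by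
  cases x with
  | smooth b hb => exact P1.dparam_ne_zero _
  | node n =>
    simp only [dualGen]
    split_ifs
    · exact div_ne_zero (P1.dparam_ne_zero _) (P1.param_ne_zero _)
    · exact neg_ne_zero.2 (div_ne_zero (P1.dparam_ne_zero _) (P1.param_ne_zero _))

theorem isDualizing_iff (x : X.Point) (v : X.FunctionRing) :
    X.IsDualizing x v ↔ v / X.dualGen x ∈ X.localRing x := by
  cases x with
  | smooth b hb =>
    change _ ↔ ∃ c, ∀ y ∈ ({b} : Set _), _
    simp [IsDualizing, dualGen]
  | node n =>
    have h0 : (v / X.dualGen (.node n)) (X.branch n 0).1 =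
        P1.param (X.branch n 0).2 * (v (X.branch n 0).1 / P1.dparam (X.branch n 0).2) := by
      have := P1.param_ne_zero (X.branch n 0).2
      have := P1.dparam_ne_zero (X.branch n 0).2
      simp only [Pi.div_apply, dualGen, if_true]
      field_simp
    have h1 : (v / X.dualGen (.node n)) (X.branch n 1).1 =
        -(P1.param (X.branch n 1).2 * (v (X.branch n 1).1 / P1.dparam (X.branch n 1).2)) := by
      have := P1.param_ne_zero (X.branch n 1).2
      have := P1.dparam_ne_zero (X.branch n 1).2
      simp only [Pi.div_apply, dualGen, if_neg (X.comp_ne n).symm]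
      field_simp
    change _ ↔ ∃ c, ∀ y ∈ Set.range (X.branch n), _
    simp only [Set.forall_mem_range, Fin.forall_fin_two, h0, h1, IsDualizing, P1.HasResidue]
    refine exists_congr fun c => and_congr_right fun _ => ⟨fun h => ?_, fun h => ?_⟩
    · simpa using h.neg
    · simpa using h.neg

theorem isDualizing_iff_exists (x : X.Point) (v : X.FunctionRing) :
    X.IsDualizing x v ↔ ∃ f ∈ X.localRing x, v = f • X.dualGen x := by
  rw [isDualizing_iff]
  constructor
  · refine fun h => ⟨_, h, ?_⟩
    funext i
    exact (div_mul_cancel₀ _ (X.dualGen_ne_zero x i)).symm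
  · rintro ⟨f, hf, rfl⟩
    convert hf
    funext i
    exact mul_div_cancel_right₀ _ (X.dualGen_ne_zero x i)

/-- The dualizing sheaf `ω_X`. The element `v` of its module of rational sections stands for the
rational differential that is `v i * dt` on the component `i`. -/
def dualizingSheaf : X.LineBundle where
  Rat := X.FunctionRing
  germ x :=
    { carrier := {v | X.IsDualizing x v}
      add_mem' := by
        intro v w hv hw
        have hv := (X.isDualizing_iff x v).1 hv
        have hw := (X.isDualizing_iff x w).1 hw
        refine (X.isDualizing_iff x _).2 ?_
        convert add_mem hv hw using 1
        funext i
        exact add_div _ _ _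
      zero_mem' := by
        refine (X.isDualizing_iff x _).2 ?_
        convert zero_mem (X.localRing x) using 1
        funext i
        exact zero_div _
      smul_mem' := by
        intro r v hv
        refine (X.isDualizing_iff x _).2 ?_
        convert mul_mem r.2 ((X.isDualizing_iff x v).1 hv) using 1
        funext i
        exact mul_div_assoc _ _ _ }
  exists_generator x := ⟨X.dualGen x, (X.isFrame_iff _).2 (X.dualGen_ne_zero x),
    X.isDualizing_iff_exists x⟩
  exists_section := by
    refine ⟨1, (X.isFrame_iff 1).2 (by simp), Set.Finite.subset
      ((Set.finite_range (Point.node (X := X))).union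
        (Set.finite_range fun i => X.proj (i, OnePoint.infty))) ?_⟩
    rintro x hx
    by_contra hx'
    simp only [Set.mem_union, Set.mem_range, not_or, not_exists] at hx'
    refine hx ⟨(X.isFrame_iff 1).2 (by simp), fun v => ?_⟩
    cases x with
    | node n => exact absurd rfl (hx'.1 n)
    | smooth b hb =>
      obtain ⟨i, p⟩ := b
      induction p using OnePoint.rec with
      | infty => exact absurd ((X.mem_over_iff _ _).1 rfl) (hx'.2 i)
      | coe a => exact X.isDualizing_iff_exists (.smooth (i, (a : OnePoint k)) hb) v

end NodalCurve

/-! ## Binary curves -/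

/-- A binary curve: a nodal curve with two components `C₀` and `C₁`, both isomorphic to `ℙ¹`. It is
the union of two copies of `ℙ¹` with the point `pt 0 n` of the first glued to the point `pt 1 n` of
the second, for every node `n`. -/
structure BinaryCurve (k : Type u) where
  Node : Type
  [finite_node : Finite Node]
  pt : Fin 2 → Node → OnePoint k
  pt_injective : ∀ i, Function.Injective (pt i)

attribute [instance] BinaryCurve.finite_node

/-- A multidegree `δ = (d₀, d₁)` of total degree `d` is balanced on a binary curve of genus `g` if
`(d - g - 1) / 2 ≤ dᵢ ≤ (d + g + 1) / 2`. -/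
def IsBalanced (g : ℤ) (δ : Fin 2 → ℤ) : Prop :=
  ∀ i, (((∑ j, δ j) - g - 1 : ℤ) : ℚ) / 2 ≤ δ i ∧ (δ i : ℚ) ≤ (((∑ j, δ j) + g + 1 : ℤ) : ℚ) / 2

/-- The multidegree is strictly balanced if these inequalities are strict. -/
def IsStrictlyBalanced (g : ℤ) (δ : Fin 2 → ℤ) : Prop :=
  ∀ i, (((∑ j, δ j) - g - 1 : ℤ) : ℚ) / 2 < δ i ∧ (δ i : ℚ) < (((∑ j, δ j) + g + 1 : ℤ) : ℚ) / 2

namespace BinaryCurve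

variable {k : Type u} (X : BinaryCurve k)

/-- The underlying nodal curve. -/
abbrev toNodalCurve : NodalCurve k where
  Comp := Fin 2
  Node := X.Node
  branch n j := (j, X.pt j n)
  branch_injective := by
    rintro ⟨n, i⟩ ⟨m, j⟩ h
    obtain ⟨rfl, h⟩ := Prod.mk.inj h
    exact congrArg (·, i) (X.pt_injective _ h)
  comp_ne n := by simp

/-- The arithmetic genus: a binary curve of genus `g` has `g + 1` nodes. -/
def genus : ℤ := Nat.card X.Node - 1

/-- The (partial) normalization `Y_S` of `X` at a set `S` of nodes. -/
def normalization (S : Set X.Node) : BinaryCurve k where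
  Node := {n // n ∉ S}
  pt i n := X.pt i n
  pt_injective i _ _ h := Subtype.ext (X.pt_injective i h)

open OnePoint in
/-- The blow-up of `X` at a set `S` of nodes. Its components are `C₀`, `C₁` and an exceptional
component `Eₙ ≅ ℙ¹` for every `n ∈ S`. The node `n ∈ S` is replaced by two nodes, in which the point
`0` of `Eₙ` is glued to the branch of `n` on `C₀`, and the point `∞` to the branch on `C₁`. -/
def blowup [Field k] (S : Set X.Node) : NodalCurve k where
  Comp := Fin 2 ⊕ S
  Node := {n // n ∉ S} ⊕ S × Fin 2
  branch
    | .inl n, j => (.inl j, X.pt j n)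
    | .inr (n, i), j => if j = 0 then (.inl i, X.pt i n) else
        (.inr n, if i = 0 then ((0 : k) : OnePoint k) else ∞)
  branch_injective := by
    rintro ⟨n | ⟨n, i⟩, j⟩ ⟨m | ⟨m, i'⟩, j'⟩ h
    · obtain ⟨h1, h2⟩ := Prod.mk.inj h
      obtain rfl := Sum.inl_injective h1
      have := X.pt_injective _ h2
      obtain rfl := Subtype.ext this
      rfl
    · exfalso
      by_cases hj : j' = 0 <;> simp [hj] at h
      obtain ⟨rfl, h2⟩ := h
      have := X.pt_injective _ h2
      exact n.2 (this ▸ m.2)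
    · exfalso
      by_cases hj : j = 0 <;> simp [hj] at h
      obtain ⟨rfl, h2⟩ := h
      have := X.pt_injective _ h2
      exact m.2 (this ▸ n.2)
    · have key : i = i' ∧ j = j' ∧ n = m := by
        by_cases hj : j = 0 <;> by_cases hj' : j' = 0 <;> simp [hj, hj'] at h
        · obtain ⟨rfl, h2⟩ := h
          exact ⟨rfl, hj.trans hj'.symm, Subtype.ext (X.pt_injective _ h2)⟩
        · obtain ⟨rfl, h2⟩ := h
          refine ⟨?_, by omega, rfl⟩
          by_cases hi : i = 0 <;> by_cases hi' : i' = 0 <;> simp [hi, hi'] at h2 <;> omega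
      obtain ⟨rfl, rfl, rfl⟩ := key
      rfl
  comp_ne := by
    rintro (n | ⟨n, i⟩) <;> simp

variable [Field k]

/-- A line bundle of total degree `d` on the blow-up of `X` at `S` is balanced if it has degree `1`
on every exceptional component and its multidegree on `C₀`, `C₁` is balanced on the partial
normalization `Y_S`. -/
def IsBalancedOn (d : ℤ) (S : Set X.Node) (L : (X.blowup S).LineBundle) : Prop :=
  L.totalDegree = d ∧ (∀ n : S, L.degree (.inr n) = 1) ∧
    IsBalanced (X.normalization S).genus fun i => L.degree (.inl i)

/-- The degree `d` balanced line bundles on the blow-ups of `X`. -/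
structure BalancedBundle (d : ℤ) where
  S : Set X.Node
  bundle : (X.blowup S).LineBundle
  isBalancedOn : X.IsBalancedOn d S bundle

variable {X} in
/-- Strictly balanced line bundles. -/
def BalancedBundle.IsStrict {d : ℤ} (A : X.BalancedBundle d) : Prop :=
  IsStrictlyBalanced (X.normalization A.S).genus fun i => A.bundle.degree (.inl i)

/-- Balanced line bundles on the same blow-up define the same point of the compactified Jacobian if
their restrictions to `Y_S = C₀ ∪ C₁` are isomorphic; moreover all balanced line bundles that are
not strictly balanced define the same point. -/
inductive BalancedBundle.Rel (d : ℤ) : X.BalancedBundle d → X.BalancedBundle d → Prop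
  | restrict (S : Set X.Node) (L M : (X.blowup S).LineBundle) (hL : X.IsBalancedOn d S L)
      (hM : X.IsBalancedOn d S M) (h : L.RestrictIso M (Set.range Sum.inl)) :
      BalancedBundle.Rel d ⟨S, L, hL⟩ ⟨S, M, hM⟩
  | notStrict (A B : X.BalancedBundle d) (hA : ¬ A.IsStrict) (hB : ¬ B.IsStrict) :
      BalancedBundle.Rel d A B

/-- The set of points of the degree `d` compactified Jacobian of `X`. -/
def CompactifiedJacobian (d : ℤ) : Type (u + 1) := Quot (BalancedBundle.Rel X d)

variable {X} in
/-- The point of the compactified Jacobian that a balanced line bundle on a blow-up represents. -/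
def BalancedBundle.toPoint {d : ℤ} (A : X.BalancedBundle d) : X.CompactifiedJacobian d :=
  Quot.mk _ A

end BinaryCurve

end

noncomputable section

open Polynomial

/-! ### Orders, values and residues on the projective line -/

namespace P1

variable {k : Type u} [Field k]

/-! Everything rests on one fact: on `ℙ¹` a nonzero section has as many zeros as its degree. It
follows from `P1.finsum_ord`.

Clifford's bound. Let `C₀` and `C₁` meet in `ν` points. A section that vanishes at `dᵢ + 1` points
of `Cᵢ` vanishes on `Cᵢ`, hence at the `ν` glued points of the other component `Cⱼ`; if it also
vanishes at `dⱼ + 1 - ν` further points of `Cⱼ`, it is zero. So `h⁰ ≤ max(dᵢ + 1, 0) + max(dⱼ + 1 -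
ν, 0)` (`finite_and_h0_le`, which also gives finiteness). Balancedness means `|d₀ - d₁| ≤ ν`, and
the two bounds together yield `d / 2 + 1` (`clifford_arith`). On a blow-up, a section on an
exceptional component has degree `1` and is determined by its values at the two glued points, so the
same bound holds with `ν` the number of nodes of `Y_S`. It holds for every balanced bundle, hence
for each representative of a point of the compactified Jacobian.

Equality for `d = 0`. The bounds force multidegree `(0, 0)`; a nonzero section then has no zeros and
trivializes `L`.

Equality for `d = 2g - 2`. The bounds force `(g - 1, g - 1)`. Fix a node `m`. For every other node
`l`, dimension count gives a nonzero section `s_l` vanishing at the `g - 1` nodes other than `m` and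
`l`; by degree these are its only zeros, and they are simple. Its counterpart in `ω` is the
differential `η_l` with simple poles over `m` and `l` and no other zeros or poles. Sending `s_n` to
`η_n`, for one chosen `n`, is an isomorphism: on each component `(s_l / s_n) η_n` has the divisor of
`η_l`, so it is a constant multiple of it. Comparison at the common node `m` shows that the two
constants agree, so generators of `L` go to generators of `ω` at every node `l`
(`iso_dualizingSheaf`). -/

theorem ord_mul (p : OnePoint k) {f g : RatFunc k} (hf : f ≠ 0) (hg : g ≠ 0) :
    ord p (f * g) = ord p f + ord p g := by
  induction p using OnePoint.rec with
  | infty =>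
    change -(f * g).intDegree = -f.intDegree + -g.intDegree
    rw [RatFunc.intDegree_mul hf hg, neg_add]
  | coe a =>
    have hfg := mul_ne_zero hf hg
    have hnf := RatFunc.num_ne_zero hf
    have hng := RatFunc.num_ne_zero hg
    have hnfg := RatFunc.num_ne_zero hfg
    have key := congrArg (rootMultiplicity a) (RatFunc.num_denom_mul f g)
    have hdf := f.denom_ne_zero
    have hdg := g.denom_ne_zero
    have hdfg := (f * g).denom_ne_zero
    rw [rootMultiplicity_mul (mul_ne_zero hnfg (mul_ne_zero hdf hdg)),
      rootMultiplicity_mul (mul_ne_zero hdf hdg),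
      rootMultiplicity_mul (mul_ne_zero (mul_ne_zero hnf hng) hdfg),
      rootMultiplicity_mul (mul_ne_zero hnf hng)] at key
    change ((f * g).num.rootMultiplicity a : ℤ) - ((f * g).denom.rootMultiplicity a : ℤ) =
      ((f.num.rootMultiplicity a : ℤ) - (f.denom.rootMultiplicity a : ℤ)) +
      ((g.num.rootMultiplicity a : ℤ) - (g.denom.rootMultiplicity a : ℤ))
    omega

theorem ord_algebraMap_coe (a : k) (P : k[X]) :
    ord (a : OnePoint k) (algebraMap k[X] (RatFunc k) P) = P.rootMultiplicity a := by
  change ((algebraMap k[X] (RatFunc k) P).num.rootMultiplicity a : ℤ) -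
    ((algebraMap k[X] (RatFunc k) P).denom.rootMultiplicity a : ℤ) = _
  rw [RatFunc.num_algebraMap, RatFunc.denom_algebraMap]
  simp [← C_1, rootMultiplicity_C, -map_one]

theorem ord_algebraMap_infty (P : k[X]) :
    ord (OnePoint.infty : OnePoint k) (algebraMap k[X] (RatFunc k) P) = -P.natDegree := by
  change -(algebraMap k[X] (RatFunc k) P).intDegree = _
  rw [RatFunc.intDegree_polynomial]

theorem algebraMap_ne_zero {P : k[X]} (hP : P ≠ 0) : algebraMap k[X] (RatFunc k) P ≠ 0 :=
  (map_ne_zero_iff _ (RatFunc.algebraMap_injective k)).2 hP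

theorem ord_one (p : OnePoint k) : ord p (1 : RatFunc k) = 0 := by
  have := ord_mul p (one_ne_zero : (1 : RatFunc k) ≠ 0) one_ne_zero
  rw [mul_one] at this
  omega

theorem ord_inv (p : OnePoint k) {f : RatFunc k} (hf : f ≠ 0) : ord p f⁻¹ = -ord p f := by
  have := ord_mul p hf (inv_ne_zero hf)
  rw [mul_inv_cancel₀ hf, ord_one] at this
  omega

theorem ord_div (p : OnePoint k) {f g : RatFunc k} (hf : f ≠ 0) (hg : g ≠ 0) :
    ord p (f / g) = ord p f - ord p g := by
  rw [div_eq_mul_inv, ord_mul p hf (inv_ne_zero hg), ord_inv p hg, sub_eq_add_neg]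

theorem ord_zpow (p : OnePoint k) {f : RatFunc k} (hf : f ≠ 0) (n : ℤ) :
    ord p (f ^ n) = n * ord p f := by
  induction n with
  | zero => simp [ord_one]
  | succ n ih => rw [zpow_add_one₀ hf, ord_mul p (zpow_ne_zero _ hf) hf, ih]; ring
  | pred n ih => rw [zpow_sub_one₀ hf, ord_mul p (zpow_ne_zero _ hf) (inv_ne_zero hf), ih,
      ord_inv p hf]; ring

theorem aeval_param_coe (a : k) (P : k[X]) :
    aeval (param (a : OnePoint k)) P = algebraMap k[X] (RatFunc k) (P.comp (X - C a)) := by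
  have h : param (a : OnePoint k) = algebraMap k[X] (RatFunc k) (X - C a) := by
    rw [map_sub, RatFunc.algebraMap_X, RatFunc.algebraMap_C]; rfl
  rw [h, aeval_algebraMap_apply, comp, aeval_def]
  rfl

/-- Substituting `1 / t` reverses the coefficients, up to a power of `t`; this reduces orders at
infinity to degrees of polynomials in `t`. -/
theorem aeval_param_infty (P : k[X]) :
    aeval (param (OnePoint.infty : OnePoint k)) P =
      algebraMap k[X] (RatFunc k) P.reverse * (RatFunc.X : RatFunc k)⁻¹ ^ P.natDegree := by
  let _ : Invertible ((RatFunc.X : RatFunc k)⁻¹) :=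
    ⟨RatFunc.X, mul_inv_cancel₀ RatFunc.X_ne_zero, inv_mul_cancel₀ RatFunc.X_ne_zero⟩
  have h := eval₂_reverse_mul_pow (algebraMap k (RatFunc k)) ((RatFunc.X : RatFunc k)⁻¹) P
  change aeval ((RatFunc.X : RatFunc k)⁻¹) P = _
  rw [aeval_def, ← h]
  congr 1
  change aeval (RatFunc.X : RatFunc k) P.reverse = _
  rw [← RatFunc.algebraMap_X, aeval_algebraMap_apply, aeval_X_left_apply]

theorem ord_infty_X : ord (OnePoint.infty : OnePoint k) (RatFunc.X : RatFunc k) = -1 := by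
  rw [← RatFunc.algebraMap_X, ord_algebraMap_infty, natDegree_X]; rfl

theorem aeval_param_ne_zero (p : OnePoint k) {P : k[X]} (hP : P ≠ 0) :
    aeval (param p) P ≠ 0 := by
  induction p using OnePoint.rec with
  | infty =>
    rw [aeval_param_infty]
    exact mul_ne_zero (algebraMap_ne_zero (by simpa using hP))
      (pow_ne_zero _ (inv_ne_zero RatFunc.X_ne_zero))
  | coe a =>
    rw [aeval_param_coe]
    refine algebraMap_ne_zero fun h => hP ?_
    have := congrArg (fun Q : k[X] => Q.comp (X + C a)) h
    simpa [comp_assoc] using this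

/-- Links `HasValue`, phrased with polynomials in the local parameter, to `ord`, phrased with
numerator and denominator in `t`. At infinity the degree of `P` cancels and its trailing degree
remains. -/
theorem ord_aeval_param (p : OnePoint k) {P : k[X]} (hP : P ≠ 0) :
    ord p (aeval (param p) P) = P.rootMultiplicity 0 := by
  induction p using OnePoint.rec with
  | infty =>
    have hX : (RatFunc.X : RatFunc k)⁻¹ ≠ 0 := inv_ne_zero RatFunc.X_ne_zero
    rw [aeval_param_infty, ord_mul _ (algebraMap_ne_zero (by simpa using hP)) (pow_ne_zero _ hX),
      ord_algebraMap_infty, ← zpow_natCast, ord_zpow _ hX, ord_inv _ RatFunc.X_ne_zero,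
      ord_infty_X, reverse_natDegree, rootMultiplicity_eq_natTrailingDegree']
    have := P.natTrailingDegree_le_natDegree
    push_cast [this]
    ring
  | coe a =>
    rw [aeval_param_coe, ord_algebraMap_coe, rootMultiplicity_eq_rootMultiplicity (t := a)]
    simp [comp_assoc]

theorem ord_param_self (p : OnePoint k) : ord p (param p) = 1 := by
  have h := ord_aeval_param p (X_ne_zero (R := k))
  rw [aeval_X] at h
  rw [h]
  simp [rootMultiplicity_eq_natTrailingDegree']

theorem rootMultiplicity_zero_of_eval_ne_zero {P : k[X]} (h : P.eval 0 ≠ 0) :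
    P.rootMultiplicity 0 = 0 :=
  rootMultiplicity_eq_zero h

theorem ne_zero_of_eval_zero_ne_zero {P : k[X]} (h : P.eval 0 ≠ 0) : P ≠ 0 := by
  rintro rfl; simp at h

theorem exists_algebraMap_eq_zpow_mul (p : OnePoint k) {P : k[X]} (hP : P ≠ 0) :
    ∃ (n : ℤ) (R : k[X]), R.eval 0 ≠ 0 ∧
      algebraMap k[X] (RatFunc k) P = param p ^ n * aeval (param p) R := by
  induction p using OnePoint.rec with
  | infty =>
    let _ : Invertible (RatFunc.X : RatFunc k) :=
      ⟨RatFunc.X⁻¹, inv_mul_cancel₀ RatFunc.X_ne_zero, mul_inv_cancel₀ RatFunc.X_ne_zero⟩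
    have h := eval₂_reverse_mul_pow (algebraMap k (RatFunc k)) (RatFunc.X : RatFunc k) P
    refine ⟨-P.natDegree, P.reverse, ?_, ?_⟩
    · rw [← coeff_zero_eq_eval_zero, coeff_zero_reverse]
      simpa using hP
    · have h1 : algebraMap k[X] (RatFunc k) P =
          eval₂ (algebraMap k (RatFunc k)) (RatFunc.X : RatFunc k) P := by
        change _ = aeval (RatFunc.X : RatFunc k) P
        rw [← RatFunc.algebraMap_X, aeval_algebraMap_apply, aeval_X_left_apply]
      rw [h1, ← h]
      change aeval ((RatFunc.X : RatFunc k)⁻¹) P.reverse * _ = ((RatFunc.X : RatFunc k)⁻¹) ^ _ *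
        aeval ((RatFunc.X : RatFunc k)⁻¹) P.reverse
      rw [mul_comm, inv_zpow, zpow_neg, inv_inv, zpow_natCast]
  | coe a =>
    refine ⟨P.rootMultiplicity a, (P /ₘ (X - C a) ^ P.rootMultiplicity a).comp (X + C a), ?_, ?_⟩
    · simpa [eval_comp] using eval_divByMonic_pow_rootMultiplicity_ne_zero a hP
    · rw [aeval_param_coe, comp_assoc]
      have h : param (a : OnePoint k) = algebraMap k[X] (RatFunc k) (X - C a) := by
        rw [map_sub, RatFunc.algebraMap_X, RatFunc.algebraMap_C]; rfl
      rw [h, zpow_natCast, ← map_pow, ← map_mul]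
      congr 1
      simpa using (pow_mul_divByMonic_rootMultiplicity_eq P a).symm

/-- Every nonzero rational function is a power of the local parameter times a unit. -/
theorem exists_mul_aeval_eq (p : OnePoint k) {f : RatFunc k} (hf : f ≠ 0) :
    ∃ P Q : k[X], P.eval 0 ≠ 0 ∧ Q.eval 0 ≠ 0 ∧
      f * aeval (param p) Q = param p ^ ord p f * aeval (param p) P := by
  obtain ⟨n, P, hP, hn⟩ := exists_algebraMap_eq_zpow_mul p (RatFunc.num_ne_zero hf)
  obtain ⟨m, Q, hQ, hm⟩ := exists_algebraMap_eq_zpow_mul p f.denom_ne_zero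
  have hp := param_ne_zero p
  have h : f * aeval (param p) Q = param p ^ (n - m) * aeval (param p) P := by
    have hd := algebraMap_ne_zero f.denom_ne_zero
    have h1 := f.num_div_denom
    rw [div_eq_iff hd, hn, hm] at h1
    have hpm := zpow_ne_zero m hp
    rw [zpow_sub₀ hp]
    field_simp
    linear_combination -h1
  have hP0 := ne_zero_of_eval_zero_ne_zero hP
  have hQ0 := ne_zero_of_eval_zero_ne_zero hQ
  -- Both `aeval` factors have order zero, so comparing orders identifies the exponent `n - m` as
  -- `ord p f`.
  have ho := congrArg (ord p) h
  rw [ord_mul p hf (aeval_param_ne_zero p hQ0), ord_mul p (zpow_ne_zero _ hp)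
    (aeval_param_ne_zero p hP0), ord_zpow p hp, ord_param_self, ord_aeval_param p hP0,
    ord_aeval_param p hQ0, rootMultiplicity_zero_of_eval_ne_zero hP,
    rootMultiplicity_zero_of_eval_ne_zero hQ] at ho
  refine ⟨P, Q, hP, hQ, ?_⟩
  rw [h]
  congr 2
  push_cast at ho
  omega

/-- Polynomials in the local parameter vanish only if they are zero, so every presentation of the
function `0` has zero numerator. -/
theorem HasValue.unique {p : OnePoint k} {f : RatFunc k} {a b : k}
    (ha : HasValue p f a) (hb : HasValue p f b) : a = b := by
  obtain ⟨P, Q, hQ, h, hv⟩ := ha.add hb.neg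
  rw [add_neg_cancel, zero_mul] at h
  have hP : P = 0 := by
    by_contra hP
    exact aeval_param_ne_zero p hP h.symm
  rw [hP, eval_zero] at hv
  have := (mul_eq_zero.1 hv.symm).resolve_right hQ
  linear_combination this

theorem HasValue.ord_nonneg {p : OnePoint k} {f : RatFunc k} {a : k}
    (h : HasValue p f a) (hf : f ≠ 0) : 0 ≤ ord p f := by
  obtain ⟨P, Q, hQ, h, -⟩ := h
  have hQ0 := ne_zero_of_eval_zero_ne_zero hQ
  have hP0 : P ≠ 0 := by
    rintro rfl
    rw [map_zero] at h
    exact mul_ne_zero hf (aeval_param_ne_zero p hQ0) h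
  have ho := congrArg (ord p) h
  rw [ord_mul p hf (aeval_param_ne_zero p hQ0), ord_aeval_param p hP0,
    ord_aeval_param p hQ0, rootMultiplicity_zero_of_eval_ne_zero hQ] at ho
  push_cast at ho
  omega

theorem exists_hasValue_of_ord_eq_zero {p : OnePoint k} {f : RatFunc k} (hf : f ≠ 0)
    (h : ord p f = 0) : ∃ a, a ≠ 0 ∧ HasValue p f a := by
  obtain ⟨P, Q, hP, hQ, hv⟩ := exists_mul_aeval_eq p hf
  refine ⟨P.eval 0 / Q.eval 0, div_ne_zero hP hQ, P, Q, hQ, ?_, (div_mul_cancel₀ _ hQ).symm⟩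
  rw [hv, h]
  simp

theorem HasValue.inv {p : OnePoint k} {f : RatFunc k} {a : k}
    (h : HasValue p f a) (ha : a ≠ 0) : HasValue p f⁻¹ a⁻¹ := by
  obtain ⟨P, Q, hQ, h, hv⟩ := h
  have hP : P.eval 0 ≠ 0 := by rw [hv]; exact mul_ne_zero ha hQ
  have hQ0 := aeval_param_ne_zero p (ne_zero_of_eval_zero_ne_zero hQ)
  have hP0 := aeval_param_ne_zero p (ne_zero_of_eval_zero_ne_zero hP)
  have hf : f ≠ 0 := by
    rintro rfl
    rw [zero_mul] at h
    exact hP0 h.symm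
  refine ⟨Q, P, hP, ?_, ?_⟩
  · rw [← h]; field_simp
  · rw [hv]; field_simp

theorem HasValue.div {p : OnePoint k} {f g : RatFunc k} {a b : k}
    (hf : HasValue p f a) (hg : HasValue p g b) (hb : b ≠ 0) : HasValue p (f / g) (a / b) := by
  rw [div_eq_mul_inv, div_eq_mul_inv]
  exact hf.mul (hg.inv hb)

theorem hasValue_zero (p : OnePoint k) : HasValue p (0 : RatFunc k) 0 := by
  simpa using hasValue_const p (0 : k)

theorem HasValue.ne_zero {p : OnePoint k} {f : RatFunc k} {a : k}
    (h : HasValue p f a) (ha : a ≠ 0) : f ≠ 0 := by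
  rintro rfl
  exact ha (h.unique (hasValue_zero p))

theorem HasValue.ord_eq_zero {p : OnePoint k} {f : RatFunc k} {a : k}
    (h : HasValue p f a) (ha : a ≠ 0) : ord p f = 0 := by
  have hf := h.ne_zero ha
  have h1 := h.ord_nonneg hf
  have h2 := (h.inv ha).ord_nonneg (inv_ne_zero hf)
  rw [ord_inv p hf] at h2
  omega

theorem HasValue.ord_pos {p : OnePoint k} {f : RatFunc k} (h : HasValue p f 0) (hf : f ≠ 0) :
    0 < ord p f := by
  refine lt_of_le_of_ne (h.ord_nonneg hf) fun h0 => ?_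
  obtain ⟨a, ha, hv⟩ := exists_hasValue_of_ord_eq_zero hf h0.symm
  exact ha (hv.unique h)

/-! ### Principal divisors -/

theorem finite_support_ord_algebraMap (P : k[X]) :
    (Function.support fun p : OnePoint k => ord p (algebraMap k[X] (RatFunc k) P)).Finite := by
  classical
  refine Set.Finite.subset ((Set.finite_singleton OnePoint.infty).union
    (P.roots.toFinset.finite_toSet.image ((↑) : k → OnePoint k))) fun p hp => ?_
  induction p using OnePoint.rec with
  | infty => exact Or.inl rfl
  | coe a =>
    refine Or.inr ⟨a, ?_, rfl⟩
    rw [Function.mem_support, ord_algebraMap_coe, Nat.cast_ne_zero, ← count_roots] at hp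
    simpa using Multiset.count_ne_zero.1 hp

/-- Over an algebraically closed field the number of roots, with multiplicity, equals the degree,
which is the order of the pole at infinity. -/
theorem finsum_ord_algebraMap [IsAlgClosed k] (P : k[X]) :
    ∑ᶠ p : OnePoint k, ord p (algebraMap k[X] (RatFunc k) P) = 0 := by
  classical
  have h1 := finite_support_ord_algebraMap P
  have h2 : Function.HasFiniteSupport
      ((fun p : Option k => ord (p : OnePoint k) (algebraMap k[X] (RatFunc k) P)) ∘ some) :=
    h1.preimage (Option.some_injective k).injOn
  refine (finsum_option h2).trans ?_
  have h3 : ∀ a : k, ord ((a : k) : OnePoint k) (algebraMap k[X] (RatFunc k) P) =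
      (P.roots.count a : ℤ) := fun a => by rw [ord_algebraMap_coe, count_roots]
  have h4 : ∑ᶠ a : k, ord ((a : k) : OnePoint k) (algebraMap k[X] (RatFunc k) P) =
      (P.natDegree : ℤ) := by
    rw [finsum_congr h3, finsum_eq_sum_of_support_subset (s := P.roots.toFinset)]
    · rw [← Nat.cast_sum, Multiset.toFinset_sum_count_eq, IsAlgClosed.card_roots_eq_natDegree]
    · intro a ha
      simpa using Multiset.count_ne_zero.1 (Nat.cast_ne_zero.1 ha)
  refine (congrArg₂ (· + ·) (ord_algebraMap_infty P) h4).trans ?_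
  simp

theorem ord_eq_num_sub_denom (p : OnePoint k) {f : RatFunc k} (hf : f ≠ 0) :
    ord p f = ord p (algebraMap k[X] (RatFunc k) f.num) -
      ord p (algebraMap k[X] (RatFunc k) f.denom) := by
  conv_lhs => rw [← f.num_div_denom]
  exact ord_div p (algebraMap_ne_zero (RatFunc.num_ne_zero hf)) (algebraMap_ne_zero f.denom_ne_zero)

theorem finite_support_ord {f : RatFunc k} (hf : f ≠ 0) :
    (Function.support fun p : OnePoint k => ord p f).Finite := by
  simp_rw [ord_eq_num_sub_denom _ hf]
  exact ((finite_support_ord_algebraMap f.num).union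
    (finite_support_ord_algebraMap f.denom)).subset (Function.support_sub _ _)

/-- A principal divisor on the projective line has degree zero. -/
theorem finsum_ord [IsAlgClosed k] {f : RatFunc k} (hf : f ≠ 0) :
    ∑ᶠ p : OnePoint k, ord p f = 0 := by
  simp_rw [ord_eq_num_sub_denom _ hf]
  rw [finsum_sub_distrib (finite_support_ord_algebraMap f.num)
    (finite_support_ord_algebraMap f.denom), finsum_ord_algebraMap f.denom,
    finsum_ord_algebraMap f.num, sub_zero]

theorem _root_.eq_zero_of_finsum_nonpos {ι : Type*} {f : ι → ℤ} (hf : ∀ i, 0 ≤ f i)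
    (hs : (Function.support f).Finite) (h : ∑ᶠ i, f i ≤ 0) (i : ι) : f i = 0 := by
  rw [finsum_eq_sum f hs] at h
  by_contra hi
  exact hi ((Finset.sum_eq_zero_iff_of_nonneg fun j _ => hf j).1
    (le_antisymm h (Finset.sum_nonneg fun j _ => hf j)) i (hs.mem_toFinset.2 hi))

/-- A rational function without zeros and poles is constant. -/
theorem exists_eq_algebraMap_of_ord_eq_zero [IsAlgClosed k] {f : RatFunc k} (hf : f ≠ 0)
    (h : ∀ p, ord p f = 0) : ∃ c : k, c ≠ 0 ∧ f = algebraMap k (RatFunc k) c := by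
  obtain ⟨c, hc, hv⟩ := exists_hasValue_of_ord_eq_zero hf (h OnePoint.infty)
  refine ⟨c, hc, ?_⟩
  by_contra hne
  -- Minus its value at infinity, `f` would have a zero there and no poles, against degree zero.
  have hg : f + -algebraMap k (RatFunc k) c ≠ 0 := by
    rwa [← sub_eq_add_neg, sub_ne_zero]
  have hvals : ∀ p a, HasValue p f a → HasValue p (f + -algebraMap k (RatFunc k) c) (a + -c) :=
    fun p a ha => ha.add (hasValue_const p c).neg
  have h0 := hvals _ _ hv
  rw [add_neg_cancel] at h0
  refine (h0.ord_pos hg).ne' (eq_zero_of_finsum_nonpos (fun p => ?_) (finite_support_ord hg)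
    (finsum_ord hg).le _)
  obtain ⟨a, -, ha⟩ := exists_hasValue_of_ord_eq_zero hf (h p)
  exact (hvals p a ha).ord_nonneg hg

open Classical in
/-- The value of a rational function at a point where it is regular. -/
def valueAt (p : OnePoint k) (f : RatFunc k) : k :=
  if h : ∃ c, HasValue p f c then h.choose else 0

theorem HasValue.valueAt_eq {p : OnePoint k} {f : RatFunc k} {c : k} (h : HasValue p f c) :
    valueAt p f = c := by
  have h' : ∃ c, HasValue p f c := ⟨c, h⟩
  rw [valueAt, dif_pos h']
  exact h'.choose_spec.unique h

/-! ### Differentials with two simple poles -/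

theorem param_coe (a : k) :
    param (a : OnePoint k) = algebraMap k[X] (RatFunc k) (X - C a) := by
  rw [map_sub, RatFunc.algebraMap_X, RatFunc.algebraMap_C]; rfl

theorem ord_coe_param_coe {a c : k} (h : a ≠ c) :
    ord (a : OnePoint k) (param (c : OnePoint k)) = 0 := by
  rw [param_coe, ord_algebraMap_coe, Nat.cast_eq_zero]
  exact rootMultiplicity_eq_zero (by simpa [IsRoot, sub_eq_zero] using h)

theorem ord_infty_param_coe (c : k) :
    ord (OnePoint.infty : OnePoint k) (param (c : OnePoint k)) = -1 := by
  rw [param_coe, ord_algebraMap_infty, natDegree_X_sub_C]; rfl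

theorem ord_neg (p : OnePoint k) {f : RatFunc k} (hf : f ≠ 0) : ord p (-f) = ord p f := by
  have h1 : HasValue p (-1 : RatFunc k) (-1) := by
    simpa using hasValue_const p (-1 : k)
  have h := ord_mul p (h1.ne_zero (by simp)) hf
  rw [h1.ord_eq_zero (by simp), neg_one_mul, zero_add] at h
  exact h

theorem ord_infty_dparam : ord OnePoint.infty (dparam (OnePoint.infty : OnePoint k)) = 2 := by
  have hX : (RatFunc.X : RatFunc k) ≠ 0 := RatFunc.X_ne_zero
  change ord OnePoint.infty (-(RatFunc.X ^ 2)⁻¹ : RatFunc k) = 2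
  rw [ord_neg _ (inv_ne_zero (pow_ne_zero _ hX)), ord_inv _ (pow_ne_zero _ hX), ← zpow_natCast,
    ord_zpow _ hX, ord_infty_X]
  rfl

theorem HasResidue.neg {p : OnePoint k} {f : RatFunc k} {c : k} (h : HasResidue p f c) :
    HasResidue p (-f) (-c) := by
  have := HasValue.neg h
  rwa [← mul_neg, ← neg_div] at this

theorem HasResidue.ord_div_dparam {p : OnePoint k} {f : RatFunc k} {c : k} (h : HasResidue p f c)
    (hf : f ≠ 0) (hc : c ≠ 0) : ord p (f / dparam p) = -1 := by
  have := HasValue.ord_eq_zero h hc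
  rw [ord_mul p (param_ne_zero p) (div_ne_zero hf (dparam_ne_zero p)), ord_param_self] at this
  omega

theorem hasResidue_inv_param_coe (a : k) :
    HasResidue (a : OnePoint k) (param (a : OnePoint k))⁻¹ 1 := by
  change HasValue _ (param (a : OnePoint k) * ((param (a : OnePoint k))⁻¹ / 1)) 1
  rw [div_one, mul_inv_cancel₀ (param_ne_zero _)]
  simpa using hasValue_const (a : OnePoint k) (1 : k)

theorem hasResidue_infty_inv_param_coe (a : k) :
    HasResidue OnePoint.infty (param (a : OnePoint k))⁻¹ (-1) := by
  have hX : (RatFunc.X : RatFunc k) ≠ 0 := RatFunc.X_ne_zero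
  have ha := param_ne_zero (a : OnePoint k)
  -- With `z = 1 / t` and `dt = -z⁻² dz`, the function to evaluate is `-1 / (1 - a z)`.
  refine ⟨-1, 1 - C a * X, by simp, ?_, by simp⟩
  change RatFunc.X⁻¹ * ((param (a : OnePoint k))⁻¹ / (-(RatFunc.X ^ 2)⁻¹)) *
    aeval (RatFunc.X : RatFunc k)⁻¹ (1 - C a * X : k[X]) =
      aeval (RatFunc.X : RatFunc k)⁻¹ (-1 : k[X])
  simp only [map_sub, map_mul, map_one, map_neg, aeval_C, aeval_X, RatFunc.algebraMap_eq_C]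
  change RatFunc.X - RatFunc.C a ≠ 0 at ha
  change RatFunc.X⁻¹ * ((RatFunc.X - RatFunc.C a)⁻¹ / (-(RatFunc.X ^ 2)⁻¹)) * _ = _
  field_simp

theorem ord_inv_param_coe_div_dparam (a : k) (r : OnePoint k) (h : r ≠ a)
    (h' : r ≠ OnePoint.infty) : ord r ((param (a : OnePoint k))⁻¹ / dparam r) = 0 := by
  induction r using OnePoint.rec with
  | infty => exact absurd rfl h'
  | coe b =>
    change ord (b : OnePoint k) ((param (a : OnePoint k))⁻¹ / 1) = 0
    rw [div_one, ord_inv _ (param_ne_zero _), ord_coe_param_coe fun h0 => h (congrArg _ h0),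
      neg_zero]

/-- A rational differential with simple poles of residues `1` and `-1` at two given points, and
without other zeros and poles. -/
theorem exists_differential {p q : OnePoint k} (hpq : p ≠ q) :
    ∃ f : RatFunc k, f ≠ 0 ∧ HasResidue p f 1 ∧ HasResidue q f (-1) ∧
      ∀ r, r ≠ p → r ≠ q → ord r (f / dparam r) = 0 := by
  induction p using OnePoint.rec with
  | infty =>
    induction q using OnePoint.rec with
    | infty => exact absurd rfl hpq
    | coe b =>
      have hb := inv_ne_zero (param_ne_zero (b : OnePoint k))
      refine ⟨-(param (b : OnePoint k))⁻¹, neg_ne_zero.2 hb, ?_,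
        (hasResidue_inv_param_coe b).neg, fun r h1 h2 => ?_⟩
      · simpa using (hasResidue_infty_inv_param_coe b).neg
      · rw [neg_div, ord_neg _ (div_ne_zero hb (dparam_ne_zero r)),
          ord_inv_param_coe_div_dparam b r h2 h1]
  | coe a =>
    have ha := param_ne_zero (a : OnePoint k)
    induction q using OnePoint.rec with
    | infty =>
      exact ⟨(param (a : OnePoint k))⁻¹, inv_ne_zero ha, hasResidue_inv_param_coe a,
        hasResidue_infty_inv_param_coe a, fun r h1 h2 => ord_inv_param_coe_div_dparam a r h1 h2⟩
    | coe b =>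
      have hb := param_ne_zero (b : OnePoint k)
      have hab : a - b ≠ 0 := sub_ne_zero.2 fun h => hpq (congrArg _ h)
      have hC : algebraMap k (RatFunc k) (a - b) ≠ 0 := (_root_.map_ne_zero _).2 hab
      have hsub : algebraMap k (RatFunc k) (a - b) =
          param (b : OnePoint k) - param (a : OnePoint k) := by
        change _ = (RatFunc.X - RatFunc.C b) - (RatFunc.X - RatFunc.C a)
        rw [RatFunc.algebraMap_eq_C, map_sub]; ring
      -- This is `dt / (t - a) - dt / (t - b)`.
      refine ⟨algebraMap k (RatFunc k) (a - b) /
        (param (a : OnePoint k) * param (b : OnePoint k)), div_ne_zero hC (mul_ne_zero ha hb),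
        ?_, ?_, fun r h1 h2 => ?_⟩
      · refine ⟨C (a - b), X + C (a - b), by simpa using hab, ?_, by simp⟩
        change param (a : OnePoint k) * (_ / 1) * _ = _
        rw [map_add, aeval_C, aeval_X, hsub]
        field_simp
        ring
      · refine ⟨C (a - b), X - C (a - b), ?_, ?_, by simp⟩
        · simp only [eval_sub, eval_X, eval_C, zero_sub]
          exact neg_ne_zero.2 hab
        change param (b : OnePoint k) * (_ / 1) * _ = _
        rw [map_sub (aeval _), aeval_C, aeval_X, hsub]
        field_simp
        ring
      · rw [ord_div r (div_ne_zero hC (mul_ne_zero ha hb)) (dparam_ne_zero r),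
          ord_div r hC (mul_ne_zero ha hb), ord_mul r ha hb,
          (hasValue_const r (a - b)).ord_eq_zero hab]
        induction r using OnePoint.rec with
        | infty =>
          -- The double zero of the function at infinity cancels the double pole of `dt`.
          rw [ord_infty_param_coe, ord_infty_param_coe, ord_infty_dparam]; rfl
        | coe c =>
          change _ - ord (c : OnePoint k) (1 : RatFunc k) = 0
          rw [ord_one, ord_coe_param_coe fun h0 => h1 (congrArg _ h0),
            ord_coe_param_coe fun h0 => h2 (congrArg _ h0)]
          rfl

end P1

/-! ### Frames and local generators on a nodal curve -/

namespace NodalCurve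

variable {k : Type u} {X : NodalCurve k}

theorem Point.over_nonempty (x : X.Point) : x.over.Nonempty := by
  cases x with
  | smooth b hb => exact ⟨b, rfl⟩
  | node n => exact ⟨_, Set.mem_range_self 0⟩

theorem proj_branch (n : X.Node) (j : Fin 2) : X.proj (X.branch n j) = .node n :=
  (X.mem_over_iff _ _).1 (Set.mem_range_self j)

variable [Field k]

/-- The units of the local ring at `x`. -/
def IsUnitAt (x : X.Point) (u : X.FunctionRing) : Prop :=
  (∀ i, u i ≠ 0) ∧ ∃ c, c ≠ 0 ∧ ∀ b ∈ x.over, P1.HasValue b.2 (u b.1) c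

theorem IsUnitAt.mem {x : X.Point} {u : X.FunctionRing} (h : IsUnitAt x u) : u ∈ X.localRing x :=
  let ⟨c, _, hc⟩ := h.2
  ⟨c, hc⟩

theorem IsUnitAt.inv {x : X.Point} {u : X.FunctionRing} (h : IsUnitAt x u) : IsUnitAt x u⁻¹ :=
  let ⟨c, h0, hc⟩ := h.2
  ⟨fun i => inv_ne_zero (h.1 i), c⁻¹, inv_ne_zero h0, fun b hb => (hc b hb).inv h0⟩

section Frame

variable {V : Type u} [AddCommGroup V] [Module X.FunctionRing V]

/-- The coordinates with respect to a frame. -/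
def IsFrame.equiv {e : V} (he : X.IsFrame e) : V ≃ₗ[X.FunctionRing] X.FunctionRing :=
  (LinearEquiv.ofBijective (LinearMap.toSpanSingleton X.FunctionRing V e) he).symm

theorem IsFrame.equiv_symm {e : V} (he : X.IsFrame e) (f : X.FunctionRing) :
    he.equiv.symm f = f • e := rfl

theorem IsFrame.equiv_smul_self {e : V} (he : X.IsFrame e) (v : V) : he.equiv v • e = v :=
  he.equiv.symm_apply_apply v

theorem IsFrame.equiv_smul {e : V} (he : X.IsFrame e) (f : X.FunctionRing) :
    he.equiv (f • e) = f :=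
  he.equiv.apply_symm_apply f

theorem IsFrame.smul_iff {e : V} (he : X.IsFrame e) (f : X.FunctionRing) :
    X.IsFrame (f • e) ↔ ∀ i, f i ≠ 0 := by
  rw [← X.isFrame_iff f]
  have h : (fun g : X.FunctionRing => g • f • e) =
      (fun g : X.FunctionRing => g • e) ∘ fun g => g • f := by
    funext g
    exact smul_smul g f e
  unfold IsFrame
  rw [h]
  exact Function.Bijective.of_comp_iff' he _

/-- Two generators differ by a unit of the local ring, and a unit is recognized by its nonzero
common value on the branches. -/
theorem Generates.smul_iff {x : X.Point} {M : Submodule (X.localRing x) V} {e : V}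
    (h : X.Generates M e) (u : X.FunctionRing) : X.Generates M (u • e) ↔ IsUnitAt x u := by
  constructor
  · intro hu
    have hu0 := (h.1.smul_iff u).1 hu.1
    obtain ⟨f, ⟨c, hc⟩, hf⟩ := (hu.2 e).1 ((h.2 e).2 ⟨1, one_mem _, (one_smul _ e).symm⟩)
    obtain ⟨g, ⟨d, hd⟩, hg⟩ := (h.2 (u • e)).1 ((hu.2 _).2 ⟨1, one_mem _, (one_smul _ _).symm⟩)
    obtain rfl : u = g := h.1.1 hg
    have h1 : (1 : X.FunctionRing) = f * u := h.1.1 (by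
      change (1 : X.FunctionRing) • e = (f * u) • e
      rw [one_smul, mul_smul, ← hf])
    refine ⟨hu0, d, ?_, hd⟩
    rintro rfl
    obtain ⟨b, hb⟩ := x.over_nonempty
    have h2 := (hc b hb).mul (hd b hb)
    have h3 : f b.1 * u b.1 = 1 := (congrFun h1 b.1).symm
    rw [h3, mul_zero] at h2
    have h4 := P1.hasValue_const b.2 (1 : k)
    rw [map_one] at h4
    exact zero_ne_one (h2.unique h4)
  · intro hu
    refine ⟨(h.1.smul_iff u).2 hu.1, fun v => (h.2 v).trans ⟨?_, ?_⟩⟩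
    · rintro ⟨f, hf, rfl⟩
      refine ⟨f * u⁻¹, mul_mem hf hu.inv.mem, ?_⟩
      rw [smul_smul]
      congr 1
      funext i
      exact (inv_mul_cancel_right₀ (hu.1 i) _).symm
    · rintro ⟨f, hf, rfl⟩
      exact ⟨f * u, mul_mem hf hu.mem, smul_smul _ _ _⟩

end Frame

/-! ### Divisors, values and zeros of sections -/

namespace LineBundle

variable (L M : X.LineBundle)

theorem generates_gen (x : X.Point) : X.Generates (L.germ x) (L.gen x) :=
  (L.exists_generator x).choose_spec

theorem coord_smul_gen (x : X.Point) (v : L.Rat) : L.coord x v • L.gen x = v :=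
  (Equiv.ofBijective _ (L.exists_generator x).choose_spec.1).apply_symm_apply v

theorem coord_eq_of_smul_gen {x : X.Point} {v : L.Rat} {f : X.FunctionRing}
    (h : f • L.gen x = v) : L.coord x v = f :=
  (L.generates_gen x).1.1 ((L.coord_smul_gen x v).trans h.symm)

theorem coord_add (x : X.Point) (v w : L.Rat) : L.coord x (v + w) = L.coord x v + L.coord x w :=
  L.coord_eq_of_smul_gen (by rw [add_smul, coord_smul_gen, coord_smul_gen])

theorem coord_smul (x : X.Point) (f : X.FunctionRing) (v : L.Rat) :
    L.coord x (f • v) = f * L.coord x v :=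
  L.coord_eq_of_smul_gen (by rw [mul_smul, coord_smul_gen])

theorem coord_smul_const (x : X.Point) (c : k) (v : L.Rat) (i : X.Comp) :
    L.coord x (c • v) i = algebraMap k (RatFunc k) c * L.coord x v i := by
  rw [← algebraMap_smul X.FunctionRing c v, coord_smul]
  rfl

theorem mem_germ_iff (x : X.Point) (v : L.Rat) : v ∈ L.germ x ↔ L.coord x v ∈ X.localRing x := by
  rw [(L.generates_gen x).2]
  constructor
  · rintro ⟨f, hf, rfl⟩
    rwa [L.coord_eq_of_smul_gen rfl]
  · exact fun h => ⟨_, h, (L.coord_smul_gen x v).symm⟩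

theorem generates_iff (x : X.Point) (v : L.Rat) :
    X.Generates (L.germ x) v ↔ IsUnitAt x (L.coord x v) := by
  rw [← (L.generates_gen x).smul_iff, coord_smul_gen]

theorem isFrame_iff_coord (x : X.Point) (v : L.Rat) : X.IsFrame v ↔ ∀ i, L.coord x v i ≠ 0 := by
  rw [← (L.generates_gen x).1.smul_iff, coord_smul_gen]

theorem isFrame_sec : X.IsFrame L.sec := L.exists_section.choose_spec.1

/-- The coordinates of the rational sections with respect to the chosen rational section. -/
def frac : L.Rat ≃ₗ[X.FunctionRing] X.FunctionRing := L.isFrame_sec.equiv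

/-- `coord` depends on the generator chosen at `x`, `frac` does not; hence vanishing on a whole
component can be tested on `frac`, and orders change by those of one fixed section. -/
theorem coord_eq_frac_mul (x : X.Point) (v : L.Rat) :
    L.coord x v = L.frac v * L.coord x L.sec := by
  rw [← coord_smul]
  exact congrArg _ (L.isFrame_sec.equiv_smul_self v).symm

theorem coord_sec_ne_zero (x : X.Point) (i : X.Comp) : L.coord x L.sec i ≠ 0 :=
  (L.isFrame_iff_coord x _).1 L.isFrame_sec i

theorem coord_ne_zero_iff (x : X.Point) (v : L.Rat) (i : X.Comp) :
    L.coord x v i ≠ 0 ↔ L.frac v i ≠ 0 := by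
  rw [coord_eq_frac_mul, Pi.mul_apply, mul_ne_zero_iff, and_iff_left (L.coord_sec_ne_zero x i)]

theorem coord_eq_zero_iff (x : X.Point) (v : L.Rat) (i : X.Comp) :
    L.coord x v i = 0 ↔ L.frac v i = 0 :=
  not_iff_not.1 (L.coord_ne_zero_iff x v i)

theorem isFrame_iff_frac (v : L.Rat) : X.IsFrame v ↔ ∀ i, L.frac v i ≠ 0 := by
  rw [← L.isFrame_sec.smul_iff]
  exact iff_of_eq (congrArg _ (L.isFrame_sec.equiv_smul_self v).symm)

/-- The order of vanishing of a rational section at a point of a component. -/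
def ordAt (i : X.Comp) (p : OnePoint k) (v : L.Rat) : ℤ := P1.ord p (L.coord (X.proj (i, p)) v i)

/-- Where the chosen section generates, its coordinate is a unit of order zero; the finitely many
other points of `X` have finitely many points over them. -/
theorem finite_support_ordAt_sec (i : X.Comp) :
    (Function.support fun p => L.ordAt i p L.sec).Finite := by
  have hfin := L.exists_section.choose_spec.2
  have h : {b : X.Comp × OnePoint k | ¬ X.Generates (L.germ (X.proj b)) L.sec}.Finite := by
    refine Set.Finite.subset (hfin.biUnion (t := fun x => x.over) fun x _ => ?_) fun b hb => ?_
    · cases x with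
      | smooth b hb => exact Set.finite_singleton b
      | node n => exact Set.finite_range _
    · exact Set.mem_biUnion hb ((X.mem_over_iff _ b).2 rfl)
  refine (h.preimage (f := fun p => (i, p)) fun p _ q _ hpq =>
    (Prod.mk.inj hpq).2).subset fun p hp hg => hp ?_
  obtain ⟨c, hc, hv⟩ := ((L.generates_iff _ _).1 hg).2
  exact (hv (i, p) ((X.mem_over_iff _ _).2 rfl)).ord_eq_zero hc

theorem ordAt_eq (i : X.Comp) (p : OnePoint k) {v : L.Rat} (hv : L.frac v i ≠ 0) :
    L.ordAt i p v = P1.ord p (L.frac v i) + L.ordAt i p L.sec := by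
  unfold ordAt
  rw [coord_eq_frac_mul, Pi.mul_apply, P1.ord_mul p hv (L.coord_sec_ne_zero _ i)]

theorem finite_support_ordAt {i : X.Comp} {v : L.Rat} (hv : L.frac v i ≠ 0) :
    (Function.support fun p => L.ordAt i p v).Finite := by
  simp_rw [L.ordAt_eq i _ hv]
  exact ((P1.finite_support_ord hv).union (L.finite_support_ordAt_sec i)).subset
    (Function.support_add _ _)

/-- The degree is the degree of the divisor of any rational section. -/
theorem finsum_ordAt [IsAlgClosed k] {i : X.Comp} {v : L.Rat} (hv : L.frac v i ≠ 0) :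
    ∑ᶠ p, L.ordAt i p v = L.degree i := by
  simp_rw [L.ordAt_eq i _ hv]
  rw [finsum_add_distrib (P1.finite_support_ord hv) (L.finite_support_ordAt_sec i),
    P1.finsum_ord hv, zero_add]
  rfl

variable {L M}

theorem exists_hasValue_of_mem_H0 {v : L.Rat} (hv : v ∈ L.H0) (x : X.Point) :
    ∃ c, ∀ i p, X.proj (i, p) = x → P1.HasValue p (L.coord (X.proj (i, p)) v i) c := by
  obtain ⟨c, hc⟩ := (L.mem_germ_iff x v).1 (hv x)
  exact ⟨c, fun i p h => h ▸ hc (i, p) ((X.mem_over_iff _ _).2 h)⟩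

theorem hasValue_of_mem_H0 {v : L.Rat} (hv : v ∈ L.H0) (i : X.Comp) (p : OnePoint k) :
    P1.HasValue p (L.coord (X.proj (i, p)) v i)
      (P1.valueAt p (L.coord (X.proj (i, p)) v i)) := by
  obtain ⟨c, hc⟩ := exists_hasValue_of_mem_H0 hv (X.proj (i, p))
  rw [(hc i p rfl).valueAt_eq]
  exact hc i p rfl

variable (L) in
/-- The value of a global section at a point of a component, with respect to the chosen local
generator of the line bundle. -/
def evalAt (i : X.Comp) (p : OnePoint k) : L.H0 →ₗ[k] k where
  toFun v := P1.valueAt p (L.coord (X.proj (i, p)) v i)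
  map_add' v w := by
    have h := (hasValue_of_mem_H0 v.2 i p).add (hasValue_of_mem_H0 w.2 i p)
    rw [← h.valueAt_eq, Submodule.coe_add, coord_add]
    rfl
  map_smul' c v := by
    have h := (P1.hasValue_const p c).mul (hasValue_of_mem_H0 v.2 i p)
    rw [RingHom.id_apply, smul_eq_mul, ← h.valueAt_eq, Submodule.coe_smul, coord_smul_const]

theorem hasValue_evalAt (v : L.H0) (i : X.Comp) (p : OnePoint k) :
    P1.HasValue p (L.coord (X.proj (i, p)) v i) (L.evalAt i p v) :=
  hasValue_of_mem_H0 v.2 i p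

/-- The values of a global section at two points that are glued agree. -/
theorem evalAt_eq_of_proj_eq (v : L.H0) {i j : X.Comp} {p q : OnePoint k}
    (h : X.proj (i, p) = X.proj (j, q)) : L.evalAt i p v = L.evalAt j q v := by
  obtain ⟨c, hc⟩ := exists_hasValue_of_mem_H0 v.2 (X.proj (j, q))
  exact ((hasValue_evalAt v i p).unique (hc i p h)).trans
    ((hc j q rfl).unique (hasValue_evalAt v j q))

theorem evalAt_eq_zero_of_frac_eq_zero {v : L.H0} {i : X.Comp} (h : L.frac v i = 0)
    (p : OnePoint k) : L.evalAt i p v = 0 := by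
  have h1 := hasValue_evalAt v i p
  rw [(L.coord_eq_zero_iff _ _ _).2 h] at h1
  exact h1.unique (P1.hasValue_zero p)

theorem ordAt_nonneg (v : L.H0) {i : X.Comp} (h : L.frac v i ≠ 0) (p : OnePoint k) :
    0 ≤ L.ordAt i p v :=
  (hasValue_evalAt v i p).ord_nonneg ((L.coord_ne_zero_iff _ _ _).2 h)

theorem ordAt_pos (v : L.H0) {i : X.Comp} (h : L.frac v i ≠ 0) {p : OnePoint k}
    (hp : L.evalAt i p v = 0) : 0 < L.ordAt i p v := by
  have h1 := hasValue_evalAt v i p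
  rw [hp] at h1
  exact h1.ord_pos ((L.coord_ne_zero_iff _ _ _).2 h)

section Zeros

-- When the section vanishes on `T`, its divisor minus `T` is effective, and this degree decides how
-- many zeros are possible.
open Classical in
theorem finsum_ordAt_sub [IsAlgClosed k] {v : L.Rat} {i : X.Comp} (h : L.frac v i ≠ 0)
    (T : Finset (OnePoint k)) :
    (Function.support fun p => L.ordAt i p v - if p ∈ T then 1 else 0).Finite ∧
      ∑ᶠ p, (L.ordAt i p v - if p ∈ T then 1 else 0) = L.degree i - T.card := by
  have hT : (Function.support fun p => if p ∈ T then (1 : ℤ) else 0).Finite :=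
    T.finite_toSet.subset fun p hp => by simpa using hp
  refine ⟨((L.finite_support_ordAt h).union hT).subset (Function.support_sub _ _), ?_⟩
  rw [finsum_sub_distrib (L.finite_support_ordAt h) hT, L.finsum_ordAt h,
    finsum_eq_sum_of_support_subset (s := T) _ fun p hp => by simpa using hp]
  simp

open Classical in
theorem ordAt_sub_nonneg {v : L.H0} {i : X.Comp} (h : L.frac v i ≠ 0)
    {T : Finset (OnePoint k)} (hT : ∀ p ∈ T, L.evalAt i p v = 0) (p : OnePoint k) :
    0 ≤ L.ordAt i p v - if p ∈ T then 1 else 0 := by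
  split_ifs with hp
  · have := ordAt_pos v h (hT p hp)
    omega
  · have := ordAt_nonneg v h p
    omega

/-- A section that does not vanish on a component has at most as many zeros there as the degree. -/
theorem card_le_degree [IsAlgClosed k] {v : L.H0} {i : X.Comp} (h : L.frac v i ≠ 0)
    {T : Finset (OnePoint k)} (hT : ∀ p ∈ T, L.evalAt i p v = 0) : (T.card : ℤ) ≤ L.degree i := by
  have h1 := finsum_nonneg (ordAt_sub_nonneg h hT)
  rw [(finsum_ordAt_sub h T).2] at h1
  omega

open Classical in
/-- A section that has the maximal number of zeros on a component has no other zeros there. -/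
theorem ordAt_eq_ite [IsAlgClosed k] {v : L.H0} {i : X.Comp} (h : L.frac v i ≠ 0)
    {T : Finset (OnePoint k)} (hT : ∀ p ∈ T, L.evalAt i p v = 0) (hd : L.degree i ≤ T.card)
    (p : OnePoint k) : L.ordAt i p v = if p ∈ T then 1 else 0 := by
  obtain ⟨h1, h2⟩ := finsum_ordAt_sub h T
  exact sub_eq_zero.1
    (eq_zero_of_finsum_nonpos (ordAt_sub_nonneg h hT) h1 (by rw [h2]; omega) p)

end Zeros

theorem frac_eq_zero_of_forall_evalAt [IsAlgClosed k] {v : L.H0} {i : X.Comp}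
    {T : Finset (OnePoint k)} (hT : ∀ p ∈ T, L.evalAt i p v = 0) (hd : L.degree i < T.card) :
    L.frac v i = 0 := by
  by_contra h
  exact hd.not_ge (card_le_degree h hT)

/-- Bound for the number of sections of a line bundle, if a section that vanishes on the components
`i` and `j` is zero: a section that vanishes on the component `i` vanishes on `j` in the points that
are glued to points of `i`. -/
theorem finite_and_h0_le [IsAlgClosed k] (i j : X.Comp) (T : Finset (OnePoint k))
    (hT : ∀ p ∈ T, ∃ q, X.proj (i, q) = X.proj (j, p))
    (hinj : ∀ v : L.H0, L.frac v i = 0 → L.frac v j = 0 → v = 0) :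
    Module.Finite k L.H0 ∧
      L.h0 ≤ (L.degree i + 1).toNat + (L.degree j + 1 - T.card).toNat := by
  classical
  have : Infinite k := IsAlgClosed.instInfinite
  have : Infinite (OnePoint k) := inferInstanceAs (Infinite (Option k))
  -- Vanishing on `A` kills a section on `i`; for negative degree `A` is empty and no condition is
  -- needed.
  obtain ⟨A, hA⟩ := Infinite.exists_subset_card_eq (OnePoint k) (L.degree i + 1).toNat
  -- `B` has more points than the degree on `j`, but only those outside `T` cost a condition.
  obtain ⟨B, hTB, hB⟩ := Infinite.exists_superset_card_eq T
    (T.card + (L.degree j + 1 - T.card).toNat) (Nat.le_add_right _ _)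
  let φ : L.H0 →ₗ[k] (A → k) × ((B \ T : Finset _) → k) :=
    (LinearMap.pi fun p : A => L.evalAt i (p : OnePoint k)).prod
      (LinearMap.pi fun p : (B \ T : Finset _) => L.evalAt j (p : OnePoint k))
  have hφ : Function.Injective φ := by
    refine (injective_iff_map_eq_zero φ).2 fun v hv => ?_
    have h1 : ∀ p ∈ A, L.evalAt i p v = 0 := fun p hp =>
      congrFun (congrArg Prod.fst hv) ⟨p, hp⟩
    have h2 : ∀ p ∈ B \ T, L.evalAt j p v = 0 := fun p hp =>
      congrFun (congrArg Prod.snd hv) ⟨p, hp⟩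
    have hi : L.frac v i = 0 := frac_eq_zero_of_forall_evalAt h1 (by omega)
    refine hinj v hi (frac_eq_zero_of_forall_evalAt (T := B) (fun p hp => ?_) (by omega))
    by_cases hpT : p ∈ T
    · obtain ⟨q, hq⟩ := hT p hpT
      rw [← evalAt_eq_of_proj_eq v hq]
      exact evalAt_eq_zero_of_frac_eq_zero hi q
    · exact h2 p (Finset.mem_sdiff.2 ⟨hp, hpT⟩)
  refine ⟨Module.Finite.of_injective φ hφ, (LinearMap.finrank_le_finrank_of_injective hφ).trans ?_⟩
  rw [Module.finrank_prod, Module.finrank_fintype_fun_eq_card, Module.finrank_fintype_fun_eq_card,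
    Fintype.card_coe, Fintype.card_coe, Finset.card_sdiff_of_subset hTB, hA, hB]
  omega

/-- Two line bundles are isomorphic if they have frames that, up to the same factors, are
generators at every point. -/
theorem iso_of_generates {s : L.Rat} {t : M.Rat} (hs : X.IsFrame s) (ht : X.IsFrame t)
    (h : ∀ x, ∃ f : X.FunctionRing, X.Generates (L.germ x) (f • s) ∧
      X.Generates (M.germ x) (f • t)) : L.Iso M := by
  refine ⟨hs.equiv.trans ht.equiv.symm, fun x v => ?_⟩
  have hφ : ∀ g : X.FunctionRing, (hs.equiv.trans ht.equiv.symm) (g • s) = g • t := fun g => by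
    rw [LinearEquiv.trans_apply, hs.equiv_smul, ht.equiv_symm]
  obtain ⟨f, h1, h2⟩ := h x
  rw [h1.2, h2.2]
  refine exists_congr fun g => and_congr_right fun _ => ?_
  rw [smul_smul, smul_smul, ← hφ, EmbeddingLike.apply_eq_iff_eq]

theorem generates_of_ordAt_eq_zero {v : L.Rat} (hv : X.IsFrame v) (b : X.Comp × OnePoint k)
    (hb : ∀ n j, X.branch n j ≠ b) (h : L.ordAt b.1 b.2 v = 0) :
    X.Generates (L.germ (.smooth b hb)) v := by
  have hx : X.proj b = .smooth b hb := (X.mem_over_iff _ _).1 rfl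
  rw [generates_iff]
  refine ⟨(L.isFrame_iff_coord _ v).1 hv, ?_⟩
  obtain ⟨c, hc, hval⟩ :=
    P1.exists_hasValue_of_ord_eq_zero ((L.isFrame_iff_coord (X.proj b) v).1 hv b.1) h
  refine ⟨c, hc, ?_⟩
  intro b' hb'
  rw [Set.mem_singleton_iff.1 hb', ← hx]
  exact hval

/-- The branches through a point share the value of `v`, so one branch suffices. -/
theorem generates_of_evalAt_ne_zero {v : L.H0} (hv : X.IsFrame (v : L.Rat)) {i : X.Comp}
    {p : OnePoint k} (h : L.evalAt i p v ≠ 0) :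
    X.Generates (L.germ (X.proj (i, p))) (v : L.Rat) := by
  rw [generates_iff]
  refine ⟨(L.isFrame_iff_coord _ _).1 hv, _, h, fun b hb => ?_⟩
  have hx := (X.mem_over_iff _ _).1 hb
  rw [← hx, ← evalAt_eq_of_proj_eq v hx]
  exact hasValue_evalAt v b.1 b.2

end LineBundle

end NodalCurve

/-! ### Generators of the structure sheaf and of the dualizing sheaf -/

namespace NodalCurve

variable {k : Type u} [Field k] (X : NodalCurve k)

theorem generates_one (x : X.Point) :
    X.Generates (X.structureSheaf.germ x) (1 : X.FunctionRing) :=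
  ⟨(X.isFrame_iff 1).2 (by simp), fun v => ⟨fun hv => ⟨v, hv, (mul_one (M := X.FunctionRing) v).symm⟩,
    by
    rintro ⟨f, hf, rfl⟩
    exact (X.localRing x).mul_mem hf (X.localRing x).one_mem⟩⟩

theorem generates_dualizingSheaf {x : X.Point} {v : X.FunctionRing}
    (h : IsUnitAt x (v / X.dualGen x)) : X.Generates (X.dualizingSheaf.germ x) v := by
  have hgen : X.Generates (X.dualizingSheaf.germ x) (X.dualGen x) :=
    ⟨(X.isFrame_iff _).2 (X.dualGen_ne_zero x), X.isDualizing_iff_exists x⟩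
  have hv := (hgen.smul_iff _).2 h
  have e : (v / X.dualGen x) • X.dualGen x = v := by
    funext i
    exact div_mul_cancel₀ _ (X.dualGen_ne_zero x i)
  exact (congrArg _ e).mp hv

theorem generates_dualizingSheaf_smooth {b : X.Comp × OnePoint k} {hb : ∀ n j, X.branch n j ≠ b}
    {v : X.FunctionRing} (hv : ∀ i, v i ≠ 0) (h : P1.ord b.2 (v b.1 / P1.dparam b.2) = 0) :
    X.Generates (X.dualizingSheaf.germ (.smooth b hb)) v := by
  refine X.generates_dualizingSheaf ⟨fun i => div_ne_zero (hv i) (X.dualGen_ne_zero _ i), ?_⟩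
  obtain ⟨c, hc, hval⟩ := P1.exists_hasValue_of_ord_eq_zero
    (div_ne_zero (hv b.1) (P1.dparam_ne_zero b.2)) h
  refine ⟨c, hc, fun b' hb' => ?_⟩
  rw [Set.mem_singleton_iff.1 hb']
  exact hval

/-- The sign in `dualGen` on the second branch turns opposite residues into equal values `c`. -/
theorem generates_dualizingSheaf_node {n : X.Node} {v : X.FunctionRing} (hv : ∀ i, v i ≠ 0) {c : k}
    (hc : c ≠ 0) (h0 : P1.HasResidue (X.branch n 0).2 (v (X.branch n 0).1) c)
    (h1 : P1.HasResidue (X.branch n 1).2 (v (X.branch n 1).1) (-c)) :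
    X.Generates (X.dualizingSheaf.germ (.node n)) v := by
  refine X.generates_dualizingSheaf
    ⟨fun i => div_ne_zero (hv i) (X.dualGen_ne_zero _ i), c, hc, ?_⟩
  have e0 : (v / X.dualGen (.node n)) (X.branch n 0).1 =
      P1.param (X.branch n 0).2 * (v (X.branch n 0).1 / P1.dparam (X.branch n 0).2) := by
    have := P1.param_ne_zero (X.branch n 0).2
    have := P1.dparam_ne_zero (X.branch n 0).2
    simp only [Pi.div_apply, dualGen, if_true]
    field_simp
  have e1 : (v / X.dualGen (.node n)) (X.branch n 1).1 =
      -(P1.param (X.branch n 1).2 * (v (X.branch n 1).1 / P1.dparam (X.branch n 1).2)) := by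
    have := P1.param_ne_zero (X.branch n 1).2
    have := P1.dparam_ne_zero (X.branch n 1).2
    simp only [Pi.div_apply, dualGen, if_neg (X.comp_ne n).symm]
    field_simp
  change ∀ b ∈ Set.range (X.branch n), _
  rw [Set.forall_mem_range, Fin.forall_fin_two, e0, e1]
  refine ⟨h0, ?_⟩
  have h2 := P1.HasValue.neg h1
  rwa [neg_neg] at h2

end NodalCurve

/-! ### Arithmetic of balanced multidegrees -/

theorem IsBalanced.abs_sub_le {g : ℤ} {δ : Fin 2 → ℤ} (h : IsBalanced g δ) :
    |δ 0 - δ 1| ≤ g + 1 := by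
  have h0 := (h 0).1
  have h1 := (h 0).2
  rw [Fin.sum_univ_two] at h0 h1
  rw [div_le_iff₀ (by norm_num)] at h0
  rw [le_div_iff₀ (by norm_num)] at h1
  have h2 : δ 0 + δ 1 - g - 1 ≤ δ 0 * 2 := by exact_mod_cast h0
  have h3 : δ 0 * 2 ≤ δ 0 + δ 1 + g + 1 := by exact_mod_cast h1
  rw [abs_le]
  omega

/-- The arithmetic of Clifford's inequality for a curve whose components `C₀` and `C₁` meet in `ν`
points and that has `s` exceptional components. -/
theorem clifford_arith {δ : Fin 2 → ℤ} {ν s h : ℕ} {d : ℤ} (hδ : |δ 0 - δ 1| ≤ ν)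
    (hsum : δ 0 + δ 1 + s = d) (hd0 : 0 ≤ d) (hd : d ≤ 2 * (ν + s - 1 : ℤ))
    (h0 : h ≤ (δ 0 + 1).toNat + (δ 1 + 1 - ν).toNat)
    (h1 : h ≤ (δ 1 + 1).toNat + (δ 0 + 1 - ν).toNat) : (h : ℚ) ≤ d / 2 + 1 := by
  -- Let `a ≤ b` be the two degrees and use the bound starting with `a`. If `b < ν`, it is `max(a +
  -- 1, 0)`, at most half of `d + 2`. If `b ≥ ν`, then `a ≥ b - ν ≥ 0`, the bound is `a + b + 2 -
  -- ν`, and the upper bound on `d` applies.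
  have key : (2 * h : ℤ) ≤ d + 2 := by
    rw [abs_le] at hδ
    omega
  have : (2 * h : ℚ) ≤ d + 2 := by exact_mod_cast key
  linarith

/-! ### Nodes as points of the components -/

namespace BinaryCurve

variable {k : Type u} (X : BinaryCurve k)

open Classical in
/-- The points of the component `i` that lie over a set of nodes. -/
def nodePts (i : Fin 2) (N : Set X.Node) : Finset (OnePoint k) :=
  (Set.toFinite (X.pt i '' N)).toFinset

variable {X}

theorem mem_nodePts {i : Fin 2} {N : Set X.Node} {p : OnePoint k} :
    p ∈ X.nodePts i N ↔ ∃ n ∈ N, X.pt i n = p := by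
  simp [nodePts]

theorem pt_mem_nodePts {i : Fin 2} {N : Set X.Node} {n : X.Node} :
    X.pt i n ∈ X.nodePts i N ↔ n ∈ N := by
  rw [mem_nodePts]
  exact ⟨fun ⟨m, hm, h⟩ => X.pt_injective i h ▸ hm, fun h => ⟨n, h, rfl⟩⟩

theorem card_nodePts (i : Fin 2) (N : Set X.Node) : (X.nodePts i N).card = Nat.card N := by
  rw [nodePts, ← Set.ncard_eq_toFinset_card _ (Set.toFinite _),
    Set.ncard_image_of_injective _ (X.pt_injective i)]
  rfl

theorem natCard_eq : (Nat.card X.Node : ℤ) = X.genus + 1 := by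
  rw [genus]; ring

theorem proj_pt (i : Fin 2) (n : X.Node) : X.toNodalCurve.proj (i, X.pt i n) = .node n :=
  NodalCurve.proj_branch (X := X.toNodalCurve) n i

theorem proj_pt_eq (i j : Fin 2) (n : X.Node) :
    X.toNodalCurve.proj (i, X.pt i n) = X.toNodalCurve.proj (j, X.pt j n) := by
  rw [proj_pt, proj_pt]

/-! ### Line bundles on the binary curve itself -/

section Smooth

variable [Field k] {L : X.toNodalCurve.LineBundle}

instance : Module X.toNodalCurve.FunctionRing L.Rat := L.module

open NodalCurve.LineBundle

theorem eq_zero_of_frac {v : L.H0} (h : ∀ i : Fin 2, L.frac v i = 0) : v = 0 :=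
  Subtype.ext (L.frac.map_eq_zero_iff.1 (funext h))

variable [IsAlgClosed k]

theorem finite_and_h0_le_of_ne {i j : Fin 2} (hij : i ≠ j) :
    Module.Finite k L.H0 ∧
      L.h0 ≤ (L.degree i + 1).toNat + (L.degree j + 1 - Nat.card X.Node).toNat := by
  have h := finite_and_h0_le (L := L) i j (X.nodePts j Set.univ) (fun p hp => by
    obtain ⟨n, -, rfl⟩ := mem_nodePts.1 hp
    exact ⟨_, proj_pt_eq i j n⟩) fun v hi hj => eq_zero_of_frac fun l => by
      obtain rfl | rfl : l = i ∨ l = j := by omega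
      exacts [hi, hj]
  rwa [card_nodePts, Nat.card_univ] at h

/-- A nonzero section vanishes on no component if the degrees are less than the number of nodes. -/
theorem frac_ne_zero {v : L.H0} (hv : v ≠ 0) (hd : ∀ i, L.degree i < Nat.card X.Node)
    (i : Fin 2) : L.frac v i ≠ 0 := by
  intro hi
  refine hv (eq_zero_of_frac fun j => ?_)
  refine frac_eq_zero_of_forall_evalAt (T := X.nodePts j Set.univ) (fun p hp => ?_) ?_
  · obtain ⟨n, -, rfl⟩ := mem_nodePts.1 hp
    rw [← evalAt_eq_of_proj_eq v (proj_pt_eq i j n)]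
    exact evalAt_eq_zero_of_frac_eq_zero hi _
  · rw [card_nodePts, Nat.card_univ]
    exact hd j

omit [IsAlgClosed k] in
theorem totalDegree_eq : L.totalDegree = L.degree 0 + L.degree 1 := by
  rw [totalDegree, finsum_eq_sum_of_fintype, Fin.sum_univ_two]

omit [IsAlgClosed k] in
/-- A section without zeros generates the line bundle everywhere. -/
theorem generates_of_ordAt_eq_zero {v : L.H0} (hv : ∀ i, L.frac v i ≠ 0) (x : X.toNodalCurve.Point)
    (h : ∀ b ∈ x.over, L.ordAt b.1 b.2 v = 0) :
    X.toNodalCurve.Generates (L.germ x) (v : L.Rat) := by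
  have hf := (L.isFrame_iff_frac (v : L.Rat)).2 hv
  cases x with
  | smooth b hb => exact NodalCurve.LineBundle.generates_of_ordAt_eq_zero hf b hb (h b rfl)
  | node n =>
    rw [← proj_pt 0 n]
    refine generates_of_evalAt_ne_zero hf fun h0 => ?_
    exact (ordAt_pos v (hv 0) h0).ne' (h (0, X.pt 0 n) ⟨0, rfl⟩)

theorem iso_structureSheaf (hg : 1 ≤ X.genus) (hL : L.totalDegree = 0)
    (hb : IsBalanced X.genus L.degree) (h : L.h0 = 1) :
    L.Iso X.toNodalCurve.structureSheaf := by
  have h1 := hb.abs_sub_le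
  rw [abs_le] at h1
  have h2 := (finite_and_h0_le_of_ne (L := L) (zero_ne_one)).2
  have h3 := (finite_and_h0_le_of_ne (L := L) (one_ne_zero)).2
  rw [natCard_eq] at h2 h3
  rw [totalDegree_eq] at hL
  -- For multidegree `(-e, e)` with `e > 0`, in either order, balancedness gives `2e ≤ g + 1`, and
  -- the bound starting with the negative degree gives `h⁰ = 0`.
  have hd : ∀ i, L.degree i = 0 := by
    rw [Fin.forall_fin_two]
    omega
  have : Nontrivial L.H0 := Module.nontrivial_of_finrank_pos (R := k) (by
    change 0 < L.h0
    omega)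
  obtain ⟨v, hv⟩ := exists_ne (0 : L.H0)
  have hv' := frac_ne_zero hv fun i => by rw [hd, natCard_eq]; omega
  refine iso_of_generates (s := (v : L.Rat)) (t := (1 : X.toNodalCurve.FunctionRing))
    ((L.isFrame_iff_frac _).2 hv') ((X.toNodalCurve.isFrame_iff 1).2 (by simp)) fun x => ⟨1, ?_, ?_⟩
  · rw [one_smul]
    refine generates_of_ordAt_eq_zero hv' x fun b _ => ?_
    rw [ordAt_eq_ite (T := ∅) (hv' b.1) (by simp) (by simp [hd])]
    simp
  · exact (congrArg _ (mul_one (1 : X.toNodalCurve.FunctionRing))).mpr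
      (X.toNodalCurve.generates_one x)

/-- The sections of a line bundle of degree `2g - 2` with `h⁰ = g`. -/
theorem exists_section_of_canonical_degree (hd : ∀ i, L.degree i = X.genus - 1)
    (h : (L.h0 : ℤ) = X.genus) {m n : X.Node} (hmn : m ≠ n) :
    ∃ v : L.H0, (∀ i, L.frac v i ≠ 0) ∧
      (∀ i p, (∀ l, X.pt i l ≠ p) → L.ordAt i p v = 0) ∧
      (∀ i, L.ordAt i (X.pt i m) v = 0) ∧ (∀ i, L.ordAt i (X.pt i n) v = 0) ∧
      ∀ i l, l ≠ m → l ≠ n → L.ordAt i (X.pt i l) v = 1 := by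
  classical
  have hfin := (finite_and_h0_le_of_ne (L := L) (zero_ne_one)).1
  have hcard : Nat.card ({m, n}ᶜ : Set X.Node) + 2 = Nat.card X.Node := by
    rw [← Set.ncard_pair hmn, add_comm]
    exact Set.ncard_add_ncard_compl {m, n}
  have hX := X.natCard_eq
  let _ : Fintype ({m, n}ᶜ : Set X.Node) := Fintype.ofFinite _
  let φ : L.H0 →ₗ[k] (({m, n}ᶜ : Set X.Node) → k) :=
    LinearMap.pi fun l : ({m, n}ᶜ : Set X.Node) => L.evalAt 0 (X.pt 0 l)
  -- Vanishing at the other `g - 1` nodes imposes `g - 1` conditions on a space of dimension `g`.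
  have hφ : LinearMap.ker φ ≠ ⊥ := by
    refine LinearMap.ker_ne_bot_of_finrank_lt ?_
    change _ < L.h0
    rw [Module.finrank_fintype_fun_eq_card, ← Nat.card_eq_fintype_card]
    omega
  obtain ⟨v, hv, hv0⟩ := Submodule.exists_mem_ne_zero_of_ne_bot hφ
  have hf := frac_ne_zero hv0 fun i => by rw [hd]; omega
  have hT : ∀ i, ∀ p ∈ X.nodePts i {m, n}ᶜ, L.evalAt i p v = 0 := by
    intro i p hp
    obtain ⟨l, hl, rfl⟩ := mem_nodePts.1 hp
    rw [evalAt_eq_of_proj_eq v (proj_pt_eq i 0 l)]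
    exact congrFun hv ⟨l, hl⟩
  -- The `g - 1` prescribed zeros on each component exhaust its degree.
  have hord := fun i p => ordAt_eq_ite (hf i) (hT i) (by rw [hd, card_nodePts]; omega) p
  refine ⟨v, hf, fun i p hp => ?_, fun i => ?_, fun i => ?_, fun i l hm hn => ?_⟩
  · rw [hord, if_neg]
    rw [mem_nodePts]
    rintro ⟨l, -, hl⟩
    exact hp l hl
  · rw [hord, if_neg (mt pt_mem_nodePts.1 (by simp))]
  · rw [hord, if_neg (mt pt_mem_nodePts.1 (by simp))]
  · rw [hord, if_pos (pt_mem_nodePts.2 (by simp [hm, hn]))]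

omit [IsAlgClosed k] in
/-- The section of the dualizing sheaf with poles at two nodes. -/
theorem exists_dualizing_section {m n : X.Node} (hmn : m ≠ n) :
    ∃ η : X.toNodalCurve.FunctionRing, (∀ i, η i ≠ 0) ∧
      (∀ i, P1.HasResidue (X.pt i m) (η i) (![1, -1] i)) ∧
      (∀ i, P1.HasResidue (X.pt i n) (η i) (-![1, -1] i)) ∧
      ∀ i r, r ≠ X.pt i m → r ≠ X.pt i n → P1.ord r (η i / P1.dparam r) = 0 := by
  choose f hf0 hfm hfn hf using fun i =>
    P1.exists_differential (p := X.pt i m) (q := X.pt i n) fun h => hmn (X.pt_injective i h)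
  -- The sign on the second component makes the residues on the two branches of a node opposite.
  refine ⟨![f 0, -f 1], ?_, ?_, ?_, ?_⟩ <;> rw [Fin.forall_fin_two]
  · exact ⟨hf0 0, neg_ne_zero.2 (hf0 1)⟩
  · exact ⟨hfm 0, (hfm 1).neg⟩
  · exact ⟨hfn 0, (hfn 1).neg⟩
  · refine ⟨hf 0, fun r h1 h2 => ?_⟩
    change P1.ord r (-f 1 / P1.dparam r) = 0
    rw [neg_div, P1.ord_neg _ (div_ne_zero (hf0 1) (P1.dparam_ne_zero r))]
    exact hf 1 r h1 h2

/-- The isomorphism matches `s n` with `η n`. Both generate at smooth points and at `m`; at another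
node `l` one passes to `s l` and `η l`, and the node `m`, common to all these sections, fixes the
scalars. -/
theorem iso_dualizingSheaf (hg : 1 ≤ X.genus) (hd : ∀ i, L.degree i = X.genus - 1)
    (h : (L.h0 : ℤ) = X.genus) : L.Iso X.toNodalCurve.dualizingSheaf := by
  have hX := X.natCard_eq
  have : Nontrivial X.Node := (Finite.one_lt_card_iff_nontrivial).1 (by omega)
  obtain ⟨m, n, hmn⟩ := exists_pair_ne X.Node
  choose s hsf hs0 hsm hsl hs1 using fun l (hl : m ≠ l) =>
    exists_section_of_canonical_degree hd h hl
  choose η hη0 hηm hηl hη using fun l (hl : m ≠ l) => X.exists_dualizing_section hl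
  have hε : ∀ i : Fin 2, (![1, -1] i : k) ≠ 0 := by
    rw [Fin.forall_fin_two]
    simp
  have hframe := fun l hl => (L.isFrame_iff_frac (s l hl : L.Rat)).2 (hsf l hl)
  refine iso_of_generates (M := X.toNodalCurve.dualizingSheaf) (s := (s n hmn : L.Rat))
    (t := η n hmn) (hframe n hmn) ((X.toNodalCurve.isFrame_iff _).2 (hη0 n hmn)) fun x => ?_
  have hone : (1 : X.toNodalCurve.FunctionRing) * η n hmn = η n hmn := one_mul _
  have hgen_m : ∀ l hl, X.toNodalCurve.Generates (L.germ (.node m)) (s l hl : L.Rat) := by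
    intro l hl
    refine generates_of_ordAt_eq_zero (hsf l hl) _ ?_
    rintro _ ⟨j, rfl⟩
    exact hsm l hl j
  cases x with
  | smooth b hb =>
    refine ⟨1, ?_, ?_⟩
    · rw [one_smul]
      refine generates_of_ordAt_eq_zero (hsf n hmn) _ ?_
      rintro b' hb'
      rw [Set.mem_singleton_iff.1 hb']
      exact hs0 n hmn b.1 b.2 fun l hl => hb l b.1 (Prod.ext rfl hl)
    · refine (congrArg _ hone).mpr
        (X.toNodalCurve.generates_dualizingSheaf_smooth (hη0 n hmn) ?_)
      exact hη n hmn b.1 b.2 (fun hl => hb m b.1 (Prod.ext rfl hl.symm))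
        fun hl => hb n b.1 (Prod.ext rfl hl.symm)
  | node l =>
    by_cases hlm : m = l
    · subst hlm
      refine ⟨1, ?_, ?_⟩
      · rw [one_smul]
        exact hgen_m n hmn
      · exact (congrArg _ hone).mpr (X.toNodalCurve.generates_dualizingSheaf_node (hη0 n hmn)
          one_ne_zero (hηm n hmn 0) (hηm n hmn 1))
    · have hf := (hframe n hmn).equiv_smul_self (s l hlm : L.Rat)
      -- Unless `l = n`, the section `s n` vanishes at `l`; the factor `f = s l / s n` replaces it
      -- by a generator there.
      set f : X.toNodalCurve.FunctionRing := (hframe n hmn).equiv (s l hlm : L.Rat) with hfdef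
      have hf0 : ∀ i, f i ≠ 0 := by
        rw [← (hframe n hmn).smul_iff, hf]
        exact hframe l hlm
      refine ⟨f, ?_, ?_⟩
      · rw [hf]
        refine generates_of_ordAt_eq_zero (hsf l hlm) _ ?_
        rintro _ ⟨j, rfl⟩
        exact hsl l hlm j
      · have hordf : ∀ i p, P1.ord p (f i) = L.ordAt i p (s l hlm) - L.ordAt i p (s n hmn) := by
          intro i p
          unfold ordAt
          rw [← hf, coord_smul, Pi.mul_apply,
            P1.ord_mul p (hf0 i) ((L.coord_ne_zero_iff _ _ _).2 (hsf n hmn i))]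
          ring
        -- `f * η n` is a constant multiple of `η l` on each component
        have hconst : ∀ i, ∃ c : k, c ≠ 0 ∧ f i * η n hmn i / η l hlm i =
            algebraMap k (RatFunc k) c := by
          intro i
          refine P1.exists_eq_algebraMap_of_ord_eq_zero
            (div_ne_zero (mul_ne_zero (hf0 i) (hη0 n hmn i)) (hη0 l hlm i)) fun p => ?_
          have e : f i * η n hmn i / η l hlm i =
              f i * (η n hmn i / P1.dparam p) / (η l hlm i / P1.dparam p) := by
            have := P1.dparam_ne_zero p
            have := hη0 l hlm i
            field_simp
          have hn0 := div_ne_zero (hη0 n hmn i) (P1.dparam_ne_zero p)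
          rw [e, P1.ord_div p (mul_ne_zero (hf0 i) hn0)
            (div_ne_zero (hη0 l hlm i) (P1.dparam_ne_zero p)), P1.ord_mul p (hf0 i) hn0, hordf]
          have hpole : ∀ l' hl', P1.ord (X.pt i m) (η l' hl' i / P1.dparam (X.pt i m)) = -1 :=
            fun l' hl' => (hηm l' hl' i).ord_div_dparam (hη0 l' hl' i) (hε i)
          have hpole' : ∀ l' hl', P1.ord (X.pt i l') (η l' hl' i / P1.dparam (X.pt i l')) = -1 :=
            fun l' hl' => (hηl l' hl' i).ord_div_dparam (hη0 l' hl' i) (neg_ne_zero.2 (hε i))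
          have hreg : ∀ l' hl' w, w ≠ m → w ≠ l' →
              P1.ord (X.pt i w) (η l' hl' i / P1.dparam (X.pt i w)) = 0 :=
            fun l' hl' w h1 h2 => hη l' hl' i _ (fun h => h1 (X.pt_injective i h))
              fun h => h2 (X.pt_injective i h)
          -- the zeros of `s l'` and the poles of `η l'` together are all nodes
          have hsum : ∀ l' hl' w, L.ordAt i (X.pt i w) (s l' hl') -
              P1.ord (X.pt i w) (η l' hl' i / P1.dparam (X.pt i w)) = 1 := by
            intro l' hl' w
            by_cases h1 : w = m
            · rw [h1, hsm l' hl', hpole]; rfl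
            · by_cases h2 : w = l'
              · subst h2
                rw [hsl w hl', hpole']; rfl
              · rw [hs1 l' hl' i w h1 h2, hreg l' hl' w h1 h2]; rfl
          by_cases hp : ∃ w, X.pt i w = p
          · obtain ⟨w, rfl⟩ := hp
            have h1 := hsum l hlm w
            have h2 := hsum n hmn w
            omega
          · have hp' : ∀ w, X.pt i w ≠ p := fun w hw => hp ⟨w, hw⟩
            rw [hs0 l hlm i p hp', hs0 n hmn i p hp', hη l hlm i p (hp' m).symm (hp' l).symm,
              hη n hmn i p (hp' m).symm (hp' n).symm]
            rfl
        choose A hA0 hA using hconst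
        -- As the quotient of two generators at `m`, `f` has one nonzero value `c` on both branches.
        -- Since `η n` and `η l` have equal residues over `m`, both constants `A i` are `c`.
        have hunit : NodalCurve.IsUnitAt (X := X.toNodalCurve) (.node m) f :=
          ((hgen_m n hmn).smul_iff f).1 (hf ▸ hgen_m l hlm)
        obtain ⟨c, hc0, hc⟩ := hunit.2
        have hAc : ∀ i, A i = c := by
          intro i
          have h1 : P1.HasValue (X.pt i m) (f i) c := hc (i, X.pt i m) ⟨i, rfl⟩
          have h2 := (h1.mul (hηm n hmn i)).div (hηm l hlm i) (hε i)
          have e : f i * (P1.param (X.pt i m) * (η n hmn i / P1.dparam (X.pt i m))) /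
              (P1.param (X.pt i m) * (η l hlm i / P1.dparam (X.pt i m))) =
              f i * η n hmn i / η l hlm i := by
            have := P1.param_ne_zero (X.pt i m)
            have := P1.dparam_ne_zero (X.pt i m)
            have := hη0 l hlm i
            field_simp
          rw [e, hA, mul_div_cancel_right₀ _ (hε i)] at h2
          exact (P1.hasValue_const _ _).unique h2
        have hres : ∀ i, P1.HasResidue (X.pt i l) (f i * η n hmn i) (c * -![1, -1] i) := by
          intro i
          have h1 := (P1.hasValue_const (X.pt i l) c).mul (hηl l hlm i)
          have h2 := hA i
          rw [hAc, div_eq_iff (hη0 l hlm i)] at h2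
          rw [P1.HasResidue, h2, mul_div_assoc, mul_left_comm]
          exact h1
        -- Here `f * η n = c * η l`, with residues `-c` and `c` on the branches of `l`.
        refine X.toNodalCurve.generates_dualizingSheaf_node (v := f * η n hmn)
          (fun i => mul_ne_zero (hf0 i) (hη0 n hmn i)) (neg_ne_zero.2 hc0) ?_ ?_
        · simpa using hres 0
        · simpa using hres 1

/-- Clifford's inequality for line bundles on a binary curve. -/
theorem finite_and_h0_le {d : ℤ} (hd0 : 0 ≤ d) (hd : d ≤ 2 * X.genus) (hL : L.totalDegree = d)
    (hb : IsBalanced X.genus L.degree) : Module.Finite k L.H0 ∧ (L.h0 : ℚ) ≤ d / 2 + 1 := by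
  have h0 := finite_and_h0_le_of_ne (L := L) zero_ne_one
  have h1 := finite_and_h0_le_of_ne (L := L) one_ne_zero
  have hX := X.natCard_eq
  have h2 := hb.abs_sub_le
  rw [← hX] at h2
  rw [totalDegree_eq] at hL
  exact ⟨h0.1, clifford_arith (s := 0) h2 (by simpa using hL) hd0 (by push_cast; omega) h0.2 h1.2⟩

/-- For degrees `g - 1 - e` and `g - 1 + e` with `e > 0`, the bound starting with the smaller one is
`(g - e) + (e - 1) = g - 1`, where `e ≤ g` by balancedness. -/
theorem degree_eq_of_canonical (hg : 1 ≤ X.genus) (hL : L.totalDegree = 2 * X.genus - 2)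
    (hb : IsBalanced X.genus L.degree) (h : (L.h0 : ℤ) = X.genus) (i : Fin 2) :
    L.degree i = X.genus - 1 := by
  have h0 := (finite_and_h0_le_of_ne (L := L) zero_ne_one).2
  have h1 := (finite_and_h0_le_of_ne (L := L) one_ne_zero).2
  have h2 := hb.abs_sub_le
  rw [abs_le] at h2
  rw [natCard_eq] at h0 h1
  rw [totalDegree_eq] at hL
  revert i
  rw [Fin.forall_fin_two]
  omega

end Smooth

/-! ### Line bundles on the blow-ups -/

section Blowup

variable {S : Set X.Node}

theorem proj_blowup_of_notMem {n : X.Node} (hn : n ∉ S) [Field k] (i : Fin 2) :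
    (X.blowup S).proj (.inl i, X.pt i n) = .node (.inl ⟨n, hn⟩) :=
  NodalCurve.proj_branch (X := X.blowup S) (.inl ⟨n, hn⟩) i

variable [Field k]

theorem proj_blowup_zero (n : S) : (X.blowup S).proj (.inr n, ((0 : k) : OnePoint k)) =
    (X.blowup S).proj (.inl 0, X.pt 0 n) :=
  (NodalCurve.proj_branch (X := X.blowup S) (.inr (n, 0)) 1).trans
    (NodalCurve.proj_branch (X := X.blowup S) (.inr (n, 0)) 0).symm

theorem proj_blowup_infty (n : S) : (X.blowup S).proj (.inr n, OnePoint.infty) =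
    (X.blowup S).proj (.inl 1, X.pt 1 n) :=
  (NodalCurve.proj_branch (X := X.blowup S) (.inr (n, 1)) 1).trans
    (NodalCurve.proj_branch (X := X.blowup S) (.inr (n, 1)) 0).symm

variable [IsAlgClosed k] {L : (X.blowup S).LineBundle}

open NodalCurve.LineBundle

/-- A section on the blow-up is determined by its restriction to `C₀ ∪ C₁`. -/
theorem eq_zero_of_frac_inl (hE : ∀ n : S, L.degree (.inr n) = 1) {v : L.H0}
    (h : ∀ i : Fin 2, L.frac v (.inl i) = 0) : v = 0 := by
  classical
  refine Subtype.ext (L.frac.map_eq_zero_iff.1 (funext ?_))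
  rintro (i | n)
  · exact h i
  -- The two glued points of an exceptional component are one more than its degree.
  · refine frac_eq_zero_of_forall_evalAt
      (T := {((0 : k) : OnePoint k), OnePoint.infty}) (fun p hp => ?_) ?_
    · rw [Finset.mem_insert, Finset.mem_singleton] at hp
      obtain rfl | rfl := hp
      · rw [evalAt_eq_of_proj_eq v (proj_blowup_zero n)]
        exact evalAt_eq_zero_of_frac_eq_zero (h 0) _
      · rw [evalAt_eq_of_proj_eq v (proj_blowup_infty n)]
        exact evalAt_eq_zero_of_frac_eq_zero (h 1) _
    · rw [hE, Finset.card_pair (OnePoint.coe_ne_infty 0)]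
      norm_num

/-- Only the nodes outside `S` still glue `C₀` to `C₁`, and the exceptional components contribute no
sections of their own. -/
theorem finite_and_h0_le_of_ne_blowup (hE : ∀ n : S, L.degree (.inr n) = 1) {i j : Fin 2}
    (hij : i ≠ j) : Module.Finite k L.H0 ∧ L.h0 ≤ (L.degree (.inl i) + 1).toNat +
      (L.degree (.inl j) + 1 - Nat.card (X.normalization S).Node).toNat := by
  have h := NodalCurve.LineBundle.finite_and_h0_le (L := L) (.inl i) (.inl j) (X.nodePts j Sᶜ)
    (fun p hp => by
      obtain ⟨n, hn, rfl⟩ := mem_nodePts.1 hp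
      exact ⟨X.pt i n, (proj_blowup_of_notMem hn i).trans (proj_blowup_of_notMem hn j).symm⟩)
    fun v hi hj => eq_zero_of_frac_inl hE fun l => by
      obtain rfl | rfl : l = i ∨ l = j := by omega
      exacts [hi, hj]
  rwa [card_nodePts] at h

omit [IsAlgClosed k] in
theorem totalDegree_blowup (hE : ∀ n : S, L.degree (.inr n) = 1) :
    L.totalDegree = L.degree (.inl 0) + L.degree (.inl 1) + Nat.card S := by
  have h : ∀ δ : Fin 2 ⊕ S → ℤ, (∀ n, δ (.inr n) = 1) →
      ∑ᶠ i, δ i = δ (.inl 0) + δ (.inl 1) + Nat.card S := by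
    intro δ hδ
    let _ : Fintype S := Fintype.ofFinite S
    rw [finsum_eq_sum_of_fintype, Fintype.sum_sum_type, Fin.sum_univ_two,
      Finset.sum_congr rfl fun n _ => hδ n]
    simp
  exact h L.degree hE

/-- Clifford's inequality for balanced line bundles on a blow-up of a binary curve. -/
theorem finite_and_h0_le_blowup {d : ℤ} (hd0 : 0 ≤ d) (hd : d ≤ 2 * X.genus)
    (hL : X.IsBalancedOn d S L) : Module.Finite k L.H0 ∧ (L.h0 : ℚ) ≤ d / 2 + 1 := by
  obtain ⟨hdeg, hE, hb⟩ := hL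
  have h0 := finite_and_h0_le_of_ne_blowup hE zero_ne_one
  have h1 := finite_and_h0_le_of_ne_blowup hE one_ne_zero
  have hX := X.natCard_eq
  have h2 : |L.degree (.inl 0) - L.degree (.inl 1)| ≤
      (Nat.card (X.normalization S).Node : ℤ) := by
    rw [natCard_eq]
    exact hb.abs_sub_le
  rw [totalDegree_blowup hE] at hdeg
  -- Each node in `S` is lost to `Y_S` but returns as one exceptional component, so `ν + s` stays `g
  -- + 1`.
  have hcard : Nat.card S + Nat.card (X.normalization S).Node = Nat.card X.Node :=
    Set.ncard_add_ncard_compl S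
  exact ⟨h0.1, clifford_arith (δ := fun i => L.degree (.inl i)) (s := Nat.card S) h2 hdeg hd0
    (by omega) h0.2 h1.2⟩

end Blowup

end BinaryCurve

end

/-! ### Clifford's inequality -/

theorem proposition3p1 {k : Type u} [Field k] [IsAlgClosed k] (X : BinaryCurve k)
    (hg : 1 ≤ X.genus) (d : ℤ) (hd₀ : 0 ≤ d) (hd : d ≤ 2 * X.genus) :
    (∀ L : X.toNodalCurve.LineBundle, L.totalDegree = d → IsBalanced X.genus L.degree →
      Module.Finite k L.H0 ∧ (L.h0 : ℚ) ≤ d / 2 + 1 ∧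
      (d = 0 → L.h0 = 1 → L.Iso X.toNodalCurve.structureSheaf) ∧
      (d = 2 * X.genus - 2 → (L.h0 : ℤ) = X.genus → L.Iso X.toNodalCurve.dualizingSheaf)) ∧
    (∀ (P : X.CompactifiedJacobian d) (L : X.BalancedBundle d), L.toPoint = P →
      Module.Finite k L.bundle.H0 ∧ (L.bundle.h0 : ℚ) ≤ d / 2 + 1) := by
  refine ⟨fun L hL hb => ?_, fun _ L _ =>
    BinaryCurve.finite_and_h0_le_blowup hd₀ hd L.isBalancedOn⟩
  obtain ⟨hfin, hle⟩ := BinaryCurve.finite_and_h0_le hd₀ hd hL hb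
  exact ⟨hfin, hle, fun h0 h1 => BinaryCurve.iso_structureSheaf hg (hL.trans h0) hb h1,
    fun h0 h1 => BinaryCurve.iso_dualizingSheaf hg
      (BinaryCurve.degree_eq_of_canonical hg (hL.trans h0) hb h1) h1⟩
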